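/- **Setting.** Let $K$ be an algebraically closed field of characteristic zero, $\ell=sl(2,K)$ with basis $x,y,h$, $[x,y]=h$, $[h,x]=2x$, $[h,y]=-2y$, and dual basis $x',y',h'$ of $\ell'$. The vertex operator Weil algebra $W$ is the Fock space over the vacuum $\mathbf 1$ of the odd modes $b_n^u, c_n^{u'}$ and the even modes $\beta_n^u,\gamma_n^{u'}$ ($u\in\{x,y,h\}$, $n\in\mathbb Z$), whose only nonzero supercommutators are $[c_n^{u'},b_m^v]=[\gamma_n^{u'},\beta_m^v]=\langle u',v\rangle\delta_{m+n,0}$; $b_n,\beta_n$ ($n\le -1$) and $c_n,\gamma_n$ ($n\le 0$) are creation operators, the others annihilate $\mathbf 1$. Let $\phi:\ell\to\ell'$ be $x\mapsto\frac12y'$, $y\mapsto\frac12x'$, $h\mapsto h'$, extend superscripts linearly, and let $u,v$ run through the basis. With $:\;:$ denoting normal ordering, put $$Q=\sum_{u,v;i,j}:\beta_{i+j}^{[u,v]}\gamma_{-i}^{v'}c_{-j}^{u'}:+\tfrac12\sum_{u,v;i,j}:b_{i+j}^{[u,v]}c_{-i}^{v'}c_{-j}^{u'}:,$$ $$h=\sum_{u,n}\gamma_{-n}^{u'}b_n^u,\quad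 k=\sum_{u,n}n\,\beta_n^uc_{-n}^{u'},\quad r=\sum_{u,n}n\,\gamma_{-n}^{\phi(u)}c_n^{u'},\quad t=\sum_{u,n}\beta_{-n}^{\phi^{-1}(u')}b_n^u,$$ $$L_0=-\sum_{u,m}m:b_m^uc_{-m}^{u'}:-\sum_{u,m}m:\beta_m^u\gamma_{-m}^{u'}:,$$ and let $W[1]$ be the weight-one space, i.e. the eigenspace of $L_0$ for the eigenvalue $1$. Put $$v^{(3)}=(\gamma_0^{h'})^2+\gamma_0^{x'}\gamma_0^{y'},\quad v^{(4)}=\gamma_0^{h'}\gamma_{-1}^{h'}+\tfrac12\gamma_0^{x'}\gamma_{-1}^{y'}+\tfrac12\gamma_0^{y'}\gamma_{-1}^{x'},\quad v^{(5)}=\beta_{-1}^h\gamma_0^{h'}+\beta_{-1}^x\gamma_0^{x'}+\beta_{-1}^y\gamma_0^{y'},$$ $$\boldsymbol h=\sum_u\gamma_0^{u'}b_{-1}^u\mathbf 1,\qquad \boldsymbol r=\sum_u\gamma_0^{\phi(u)}c_{-1}^{u'}\mathbf 1 .$$ **Theorem.** $W[1]$ is the direct sum of its four $Q$-stable subspaces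 $W[1]\cap \mathrm{Ker}\,h\cap \mathrm{Ker}\,r$, $W[1]\cap \mathrm{Ker}\,h\cap \mathrm{Ker}\,t$, $W[1]\cap \mathrm{Ker}\,k\cap \mathrm{Ker}\,r$, $W[1]\cap \mathrm{Ker}\,k\cap \mathrm{Ker}\,t$. The maps $t$, $k$, $kt$ restrict to isomorphisms of the first summand onto the second, the third and the fourth respectively, and they commute with $Q$ up to sign ($Qt=-tQ$, $Qk=-kQ$). For every $n\ge 0$ the element $\{v^{(3)}\}^nv^{(4)}\mathbf 1$ lies in $\mathrm{Ker}\,Q\cap \mathrm{Ker}\,h\cap \mathrm{Ker}\,r$ and in $W[1]$, and its images in the other three summands are, up to sign, $\{v^{(3)}\}^n\boldsymbol h$ in $\mathrm{Ker}\,h\cap \mathrm{Ker}\,t$, $\{v^{(3)}\}^n\boldsymbol r$ in $\mathrm{Ker}\,k\cap \mathrm{Ker}\,r$ and $\{v^{(3)}\}^nv^{(5)}\mathbf 1$ in $\mathrm{Ker}\,k\cap \mathrm{Ker}\,t$; precisely, $$t\{v^{(3)}\}^nv^{(4)}\mathbf 1=-\{v^{(3)}\}^n\boldsymbol h,\quad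 k\{v^{(3)}\}^nv^{(4)}\mathbf 1=-\{v^{(3)}\}^n\boldsymbol r,\quad kt\{v^{(3)}\}^nv^{(4)}\mathbf 1=\{v^{(3)}\}^nv^{(5)}\mathbf 1 .$$ All these elements are $Q$-closed and none of them is $Q$-exact. There are infinitely many weight-one classes: for each of the four families, the classes for $n=0,1,2,\dots$ are linearly independent in $\mathrm{Ker}\,Q/\mathrm{Im}\,Q$. -/

import Mathlib

open scoped TensorProduct

noncomputable section

namespace VOWA

/-! ### The Fock space and the modes -/

/-- Labels of the creation operators over a basis `(u_i)` of the Lie algebra: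
`low i n` stands for the mode `-n-1` of `β^{u_i}` (or `b^{u_i}`), and
`up i n` stands for the mode `-n` of `γ^{u_i'}` (or `c^{u_i'}`). -/
inductive Osc (ι : Type*)
  | low (i : ι) (n : ℕ) : Osc ι
  | up (i : ι) (n : ℕ) : Osc ι

/-- The label `n` of an oscillator. -/
def Osc.level {ι : Type*} : Osc ι → ℕ
  | .low _ n => n
  | .up _ n => n

/-- The underlying space of the vertex operator Weil algebra: the semi-infinite symmetric module
(polynomials in the creation operators `β_n`, `n ≤ -1`, and `γ_n`, `n ≤ 0`) tensored with the
semi-infinite exterior module (exterior algebra on the creation operators `b_n`, `n ≤ -1`, and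
`c_n`, `n ≤ 0`). -/
abbrev Weil (K : Type*) [Field K] (ι : Type*) :=
  MvPolynomial (Osc ι) K ⊗[K] ExteriorAlgebra K (Osc ι →₀ K)

/-- The four kinds of generators; `beta`, `gamma` are even, `b`, `c` are odd. -/
inductive Kind : Type
  | b | c | beta | gamma

/-- Parity of a generator. -/
def Kind.odd : Kind → Bool
  | .b => true
  | .c => true
  | .beta => false
  | .gamma => false

/-- `b_n`, `β_n` with `n ≤ -1` and `c_n`, `γ_n` with `n ≤ 0` are the creation operators;
all other modes are annihilation operators. -/
def Kind.creation : Kind → ℤ → Bool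
  | .b, n => decide (n ≤ -1)
  | .beta, n => decide (n ≤ -1)
  | .c, n => decide (n ≤ 0)
  | .gamma, n => decide (n ≤ 0)

section Modes

variable (K : Type*) [Field K] {ι : Type*}

/-- The vacuum vector. -/
def vac (ι : Type*) : Weil K ι := 1 ⊗ₜ[K] 1

/-- Multiplication by a symmetric creation operator. -/
def symMul (g : Osc ι) : Module.End K (Weil K ι) :=
  LinearMap.rTensor _ (LinearMap.mulLeft K (MvPolynomial.X g))

/-- Partial derivative with respect to a symmetric creation operator. -/
def symDer (g : Osc ι) : Module.End K (Weil K ι) :=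
  LinearMap.rTensor _ (MvPolynomial.pderiv g).toLinearMap

/-- Left exterior multiplication by an exterior creation operator. -/
def extMul (g : Osc ι) : Module.End K (Weil K ι) :=
  LinearMap.lTensor _ (LinearMap.mulLeft K (ExteriorAlgebra.ι K (Finsupp.single g 1)))

/-- Contraction with respect to an exterior creation operator. -/
def extDer (g : Osc ι) : Module.End K (Weil K ι) :=
  LinearMap.lTensor _ (CliffordAlgebra.contractLeft (Q := (0 : QuadraticForm K (Osc ι →₀ K)))
    (Finsupp.lapply g))

/-- The modes `b_n^{u_i}`, `c_n^{u_i'}`, `β_n^{u_i}`, `γ_n^{u_i'}` as operators. They satisfy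
`[c_n^{u_i'}, b_m^{u_j}] = [γ_n^{u_i'}, β_m^{u_j}] = δ_{ij} δ_{m+n,0}`, all other supercommutators
vanish, and the annihilation operators kill the vacuum. -/
def mode : Kind → ℤ → ι → Module.End K (Weil K ι)
  | .beta, .negSucc n, i => symMul K (.low i n)
  | .beta, .ofNat n, i => -symDer K (.up i n)
  | .b, .negSucc n, i => extMul K (.low i n)
  | .b, .ofNat n, i => extDer K (.up i n)
  | .gamma, .negSucc n, i => symMul K (.up i (n + 1))
  | .gamma, .ofNat 0, i => symMul K (.up i 0)
  | .gamma, .ofNat (n + 1), i => symDer K (.low i n)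
  | .c, .negSucc n, i => extMul K (.up i (n + 1))
  | .c, .ofNat 0, i => extMul K (.up i 0)
  | .c, .ofNat (n + 1), i => extDer K (.low i n)

/-- Normally ordered product of modes: annihilation operators are moved to the right, with a sign
for each exchange of two odd operators. -/
def nord : List (Kind × ℤ × ι) → Module.End K (Weil K ι)
  | [] => 1
  | (s, n, i) :: l =>
    if s.creation n then mode K s n i * nord l
    else if s.odd && (l.countP fun a => a.1.odd) % 2 == 1 then -(nord l * mode K s n i)
    else nord l * mode K s n i

end Modes

/-! ### Infinite sums of normally ordered products are locally finite -/

section Finiteness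

variable {K : Type*} [Field K] {ι : Type*}

/-- The operator `w ↦ ∑_a T_a w` for a family of operators of which only finitely many
do not kill a given vector. -/
def locSum {I : Type*} (T : I → Module.End K (Weil K ι))
    (hT : ∀ w, (Function.support fun a => T a w).Finite) : Module.End K (Weil K ι) where
  toFun w := ∑ᶠ a, T a w
  map_add' v w := by
    simp only [map_add]
    exact finsum_add_distrib (hT v) (hT w)
  map_smul' c w := by
    simp only [map_smul, RingHom.id_apply]
    exact (smul_finsum' c (hT w)).symm

theorem symDer_comm (g g' : Osc ι) (w : Weil K ι) :
    symDer K g (symDer K g' w) = symDer K g' (symDer K g w) := by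
  classical
  have h (p : MvPolynomial (Osc ι) K) : MvPolynomial.pderiv g (MvPolynomial.pderiv g' p) =
      MvPolynomial.pderiv g' (MvPolynomial.pderiv g p) := by
    have h0 : ⁅MvPolynomial.pderiv (R := K) g, MvPolynomial.pderiv (R := K) g'⁆ = 0 := by
      apply MvPolynomial.derivation_ext
      intro i
      rw [Derivation.commutator_apply]
      simp [MvPolynomial.pderiv_X, Pi.single_apply, apply_ite]
    have := congrArg (fun D => D p) h0
    simpa [Derivation.commutator_apply, sub_eq_zero] using this
  induction w using TensorProduct.induction_on with
  | zero => simp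
  | tmul p e => simp [symDer, h]
  | add x y hx hy => simp only [map_add, hx, hy]

theorem extDer_comm (g g' : Osc ι) (w : Weil K ι) :
    extDer K g (extDer K g' w) = -extDer K g' (extDer K g w) := by
  induction w using TensorProduct.induction_on with
  | zero => simp
  | tmul p e =>
    simp only [extDer, LinearMap.lTensor_tmul]
    rw [CliffordAlgebra.contractLeft_comm, TensorProduct.tmul_neg]
  | add x y hx hy => simp only [map_add, hx, hy, neg_add]

theorem symDer_extDer (g g' : Osc ι) (w : Weil K ι) :
    symDer K g (extDer K g' w) = extDer K g' (symDer K g w) := by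
  simp only [symDer, extDer, ← LinearMap.comp_apply, LinearMap.rTensor_comp_lTensor,
    LinearMap.lTensor_comp_rTensor]

/-- All oscillators of level at least `N` are absent from `w`. -/
def Bounded (N : ℕ) (w : Weil K ι) : Prop :=
  ∀ g : Osc ι, N ≤ g.level → symDer K g w = 0 ∧ extDer K g w = 0

theorem exists_bounded (w : Weil K ι) : ∃ N, Bounded N w := by
  classical
  induction w using TensorProduct.induction_on with
  | zero => exact ⟨0, fun g _ => by simp⟩
  | add x y hx hy =>
    obtain ⟨N, hN⟩ := hx
    obtain ⟨M, hM⟩ := hy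
    refine ⟨max N M, fun g hg => ?_⟩
    have h1 := hN g (le_trans (le_max_left _ _) hg)
    have h2 := hM g (le_trans (le_max_right _ _) hg)
    simp [h1, h2]
  | tmul p e =>
    have hfin : ∀ s : Finset (Osc ι), ∃ N, ∀ g, N ≤ g.level → g ∉ s := fun s =>
      ⟨s.sup Osc.level + 1, fun g hg hgs => by
        have := Finset.le_sup (f := Osc.level) hgs
        omega⟩
    have hp : ∃ N, ∀ g : Osc ι, N ≤ g.level → MvPolynomial.pderiv g p = 0 := by
      obtain ⟨N, hN⟩ := hfin p.vars
      exact ⟨N, fun g hg => MvPolynomial.pderiv_eq_zero_of_notMem_vars (hN g hg)⟩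
    have he : ∃ N, ∀ g : Osc ι, N ≤ g.level →
        CliffordAlgebra.contractLeft (Q := (0 : QuadraticForm K (Osc ι →₀ K)))
          (Finsupp.lapply g) e = 0 := by
      induction e using CliffordAlgebra.left_induction with
      | algebraMap r => exact ⟨0, fun g _ => CliffordAlgebra.contractLeft_algebraMap _ _ _⟩
      | add x y hx hy =>
        obtain ⟨N, hN⟩ := hx
        obtain ⟨M, hM⟩ := hy
        refine ⟨max N M, fun g hg => ?_⟩
        rw [map_add, hN g (le_trans (le_max_left _ _) hg),
          hM g (le_trans (le_max_right _ _) hg), add_zero]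
      | ι_mul x m hx =>
        obtain ⟨N, hN⟩ := hx
        obtain ⟨M, hM⟩ := hfin m.support
        refine ⟨max N M, fun g hg => ?_⟩
        rw [CliffordAlgebra.contractLeft_ι_mul, hN g (le_trans (le_max_left _ _) hg)]
        have := Finsupp.notMem_support_iff.1 (hM g (le_trans (le_max_right _ _) hg))
        simp [this]
    obtain ⟨N, hN⟩ := hp
    obtain ⟨M, hM⟩ := he
    refine ⟨max N M, fun g hg => ⟨?_, ?_⟩⟩
    · have h := hN g (le_trans (le_max_left _ _) hg)
      simp [symDer, h]
    · simp [extDer, hM g (le_trans (le_max_right _ _) hg)]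

/-- An annihilation operator is, up to sign, a derivative or a contraction. -/
theorem mode_annihilation (s : Kind) (n : ℤ) (i : ι) (h : s.creation n = false) :
    ∃ g : Osc ι, n ≤ g.level + 1 ∧
      (mode K s n i = symDer K g ∨ mode K s n i = -symDer K g ∨ mode K s n i = extDer K g) := by
  match s, n, h with
  | .b, .ofNat n, _ => exact ⟨.up i n, by simp [Osc.level], Or.inr (Or.inr rfl)⟩
  | .b, .negSucc n, h => simp [Kind.creation] at h; omega
  | .beta, .ofNat n, _ => exact ⟨.up i n, by simp [Osc.level], Or.inr (Or.inl rfl)⟩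
  | .beta, .negSucc n, h => simp [Kind.creation] at h; omega
  | .c, .ofNat (n + 1), _ => exact ⟨.low i n, by simp [Osc.level], Or.inr (Or.inr rfl)⟩
  | .c, .ofNat 0, h => simp [Kind.creation] at h
  | .c, .negSucc n, h => simp [Kind.creation] at h
  | .gamma, .ofNat (n + 1), _ => exact ⟨.low i n, by simp [Osc.level], Or.inl rfl⟩
  | .gamma, .ofNat 0, h => simp [Kind.creation] at h
  | .gamma, .negSucc n, h => simp [Kind.creation] at h

theorem mode_large {N : ℕ} {w : Weil K ι} (hw : Bounded N w) {s : Kind} {n : ℤ} (i : ι)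
    (hn : (N : ℤ) + 1 ≤ n) : mode K s n i w = 0 := by
  have hc : s.creation n = false := by
    cases s <;> simp [Kind.creation] <;> omega
  obtain ⟨g, hg, h⟩ := mode_annihilation (K := K) s n i hc
  have hb := hw g (by omega)
  rcases h with h | h | h <;> simp [h, hb]

theorem Bounded.mode {N : ℕ} {w : Weil K ι} (hw : Bounded N w) {s : Kind} {n : ℤ} (i : ι)
    (hc : s.creation n = false) : Bounded N (mode K s n i w) := by
  obtain ⟨g, _, h⟩ := mode_annihilation (K := K) s n i hc
  intro g' hg'
  have hb := hw g' hg'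
  rcases h with h | h | h
  · rw [h]
    exact ⟨by rw [symDer_comm, hb.1, map_zero], by rw [← symDer_extDer, hb.2, map_zero]⟩
  · rw [h]
    simp only [LinearMap.neg_apply, map_neg, neg_eq_zero]
    exact ⟨by rw [symDer_comm, hb.1, map_zero], by rw [← symDer_extDer, hb.2, map_zero]⟩
  · rw [h]
    exact ⟨by rw [symDer_extDer, hb.1, map_zero], by rw [extDer_comm, hb.2, map_zero, neg_zero]⟩

theorem nord_large {N : ℕ} (l : List (Kind × ℤ × ι)) :
    ∀ {w : Weil K ι}, Bounded N w → (∃ a ∈ l, (N : ℤ) + 1 ≤ a.2.1) → nord K l w = 0 := by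
  induction l with
  | nil => intro w _ h; simp at h
  | cons a l ih =>
    obtain ⟨s, n, i⟩ := a
    intro w hw h
    have key : s.creation n = false → nord K l (mode K s n i w) = 0 := by
      intro hc
      rcases List.exists_mem_cons_iff .. |>.1 h with h | h
      · rw [mode_large hw i h, map_zero]
      · exact ih (hw.mode i hc) h
    unfold nord
    split_ifs with h1 h2
    · rcases List.exists_mem_cons_iff .. |>.1 h with h | h
      · exfalso
        cases s <;> simp [Kind.creation] at h1 h <;> omega
      · simp [ih hw h]
    · simp [key (by simpa using h1)]
    · simp [key (by simpa using h1)]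

/-- Criterion for local finiteness. -/
theorem nord_locFinite {I J : Type*} [Fintype J] (coef : I → J → K)
    (l : I → J → List (Kind × ℤ × ι))
    (hl : ∀ N : ℤ, {a | ∃ j, ∀ x ∈ l a j, x.2.1 ≤ N}.Finite) (w : Weil K ι) :
    (Function.support fun a => (∑ j, coef a j • nord K (l a j)) w).Finite := by
  obtain ⟨N, hN⟩ := exists_bounded w
  refine (hl N).subset fun a ha => ?_
  by_contra hcon
  apply ha
  simp only [LinearMap.sum_apply, LinearMap.smul_apply]
  refine Finset.sum_eq_zero fun j _ => ?_
  simp only [Set.mem_ofPred_eq, not_exists, not_forall, not_le] at hcon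
  obtain ⟨x, hx, hxN⟩ := hcon j
  rw [nord_large (l a j) hN ⟨x, hx, by omega⟩, smul_zero]

/-- The sum over `a` in `I` of the operators `∑_j coef a j • :l a j:`. -/
def nordSum {I J : Type*} [Fintype J] (coef : I → J → K) (l : I → J → List (Kind × ℤ × ι))
    (hl : ∀ N : ℤ, {a | ∃ j, ∀ x ∈ l a j, x.2.1 ≤ N}.Finite) : Module.End K (Weil K ι) :=
  locSum (fun a => ∑ j, coef a j • nord K (l a j)) (nord_locFinite coef l hl)

theorem finite_pairs {S : Type*} [Finite S] {P : S × ℤ → Prop} {A B : ℤ}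
    (h : ∀ a, P a → A ≤ a.2 ∧ a.2 ≤ B) : {a | P a}.Finite :=
  ((Set.finite_univ (α := S)).prod (Set.finite_Icc A B)).subset
    fun a ha => ⟨Set.mem_univ _, h a ha⟩

theorem finite_triples {S : Type*} [Finite S] {P : S × ℤ × ℤ → Prop} {A B : ℤ}
    (h : ∀ a, P a → (A ≤ a.2.1 ∧ a.2.1 ≤ B) ∧ (A ≤ a.2.2 ∧ a.2.2 ≤ B)) : {a | P a}.Finite :=
  ((Set.finite_univ (α := S)).prod ((Set.finite_Icc A B).prod (Set.finite_Icc A B))).subset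
    fun a ha => ⟨Set.mem_univ _, h a ha⟩

end Finiteness

/-! ### The standard operators -/

section Operators

variable {K : Type*} [Field K] {ι : Type*} [Fintype ι]

/-- `L_0 = -∑_{u,m} m :b_m^u c_{-m}^{u'}: - ∑_{u,m} m :β_m^u γ_{-m}^{u'}:`. Its eigenvalues are
the weights (degrees). -/
def L0 (K : Type*) [Field K] (ι : Type*) [Fintype ι] : Module.End K (Weil K ι) :=
  -nordSum (fun (a : ι × ℤ) (_ : Unit) => (a.2 : K))
      (fun a _ => [(.b, a.2, a.1), (.c, -a.2, a.1)])
      (fun N => finite_pairs (A := -N) (B := N) fun a ha => by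
        simp at ha; omega)
    - nordSum (fun (a : ι × ℤ) (_ : Unit) => (a.2 : K))
      (fun a _ => [(.beta, a.2, a.1), (.gamma, -a.2, a.1)])
      (fun N => finite_pairs (A := -N) (B := N) fun a ha => by
        simp at ha; omega)

/-- The Koszul differential `h = ∑_{u,n} γ_{-n}^{u'} b_n^u`. -/
def koszul (K : Type*) [Field K] (ι : Type*) [Fintype ι] : Module.End K (Weil K ι) :=
  nordSum (fun (_ : ι × ℤ) (_ : Unit) => (1 : K))
    (fun a _ => [(.gamma, -a.2, a.1), (.b, a.2, a.1)])
    (fun N => finite_pairs (A := -N) (B := N) fun a ha => by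
      simp at ha; omega)

/-- The homotopy operator `k = ∑_{u,n} n β_n^u c_{-n}^{u'}`. -/
def homotopy (K : Type*) [Field K] (ι : Type*) [Fintype ι] : Module.End K (Weil K ι) :=
  nordSum (fun (a : ι × ℤ) (_ : Unit) => (a.2 : K))
    (fun a _ => [(.beta, a.2, a.1), (.c, -a.2, a.1)])
    (fun N => finite_pairs (A := -N) (B := N) fun a ha => by
      simp at ha; omega)

variable {L : Type*} [LieRing L] [LieAlgebra K L] (B : Module.Basis ι K L)

/-- The semi-infinite cohomology differential of the loop algebra of `L`,
`Q = ∑_{u,v;i,j} :β_{i+j}^{[u,v]} γ_{-i}^{v'} c_{-j}^{u'}: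
  + (1/2) ∑_{u,v;i,j} :b_{i+j}^{[u,v]} c_{-i}^{v'} c_{-j}^{u'}:`,
where `β^{[u,v]}` and `b^{[u,v]}` are expanded in the basis. -/
def Q : Module.End K (Weil K ι) :=
  nordSum (fun (a : (ι × ι) × ℤ × ℤ) (w : ι) => B.repr ⁅B a.1.1, B a.1.2⁆ w)
      (fun a w => [(.beta, a.2.1 + a.2.2, w), (.gamma, -a.2.1, a.1.2), (.c, -a.2.2, a.1.1)])
      (fun N => finite_triples (A := -N) (B := 2 * N) fun a ha => by
        simp at ha; omega)
    + (1 / 2 : K) •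
      nordSum (fun (a : (ι × ι) × ℤ × ℤ) (w : ι) => B.repr ⁅B a.1.1, B a.1.2⁆ w)
      (fun a w => [(.b, a.2.1 + a.2.2, w), (.c, -a.2.1, a.1.2), (.c, -a.2.2, a.1.1)])
      (fun N => finite_triples (A := -N) (B := 2 * N) fun a ha => by
        simp at ha; omega)

/-- `r = ∑_{u,n} n γ_{-n}^{φ(u)} c_n^{u'}`, where `γ^{φ(u)}` is expanded in the dual basis. -/
def rOp (φ : L ≃ₗ[K] Module.Dual K L) : Module.End K (Weil K ι) :=
  nordSum (fun (a : ι × ℤ) (w : ι) => (a.2 : K) * φ (B a.1) (B w))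
    (fun a w => [(.gamma, -a.2, w), (.c, a.2, a.1)])
    (fun N => finite_pairs (A := -N) (B := N) fun a ha => by
      simp at ha; omega)

/-- `t = ∑_{u,n} β_{-n}^{φ⁻¹(u')} b_n^u`, where `β^{φ⁻¹(u')}` is expanded in the basis. -/
def tOp (φ : L ≃ₗ[K] Module.Dual K L) : Module.End K (Weil K ι) :=
  nordSum (fun (a : ι × ℤ) (w : ι) => B.repr (φ.symm (B.coord a.1)) w)
    (fun a w => [(.beta, -a.2, w), (.b, a.2, a.1)])
    (fun N => finite_pairs (A := -N) (B := N) fun a ha => by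
      simp at ha; omega)

end Operators

/-- The cohomology `Ker D / Im D`. -/
abbrev Cohomology {K : Type*} [Field K] {V : Type*} [AddCommGroup V] [Module K V]
    (D : Module.End K V) :=
  LinearMap.ker D ⧸ (LinearMap.range D).submoduleOf (LinearMap.ker D)

/-! ### The case of `sl(2)` -/

section Sl2

attribute [local instance] LieRing.ofAssociativeRing

variable (K : Type*) [Field K]

/-- The Lie algebra of traceless two by two matrices. -/
abbrev Sl2 := LieAlgebra.SpecialLinear.sl (Fin 2) K

/-- The basis `x = E_{01}`, `y = E_{10}`, `h = E_{00} - E_{11}` (in this order), with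
`[x,y] = h`, `[h,x] = 2x`, `[h,y] = -2y`. -/
def sl2Basis : Module.Basis (Fin 3) K (Sl2 K) :=
  Module.Basis.ofEquivFun
    { toFun := fun A => ![A.1 0 1, A.1 1 0, A.1 0 0]
      invFun := fun v => ⟨!![v 2, v 0; v 1, -v 2], by
        change Matrix.trace !![v 2, v 0; v 1, -v 2] = 0
        simp [Matrix.trace_fin_two]⟩
      map_add' := fun A A' => by ext i; fin_cases i <;> simp
      map_smul' := fun c A => by ext i; fin_cases i <;> simp
      left_inv := fun A => by
        have h : A.1 0 0 + A.1 1 1 = 0 := by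
          rw [← Matrix.trace_fin_two]
          exact A.2
        have h' : A.1 1 1 = -A.1 0 0 := by linear_combination h
        ext i j
        fin_cases i <;> fin_cases j <;> simp [h']
      right_inv := fun v => by ext i; fin_cases i <;> simp }

/-- The invariant isomorphism `x ↦ y'/2`, `y ↦ x'/2`, `h ↦ h'`, given by the invariant form with
`(x,y) = 1/2`, `(h,h) = 1`; its inverse is `x' ↦ 2y`, `y' ↦ 2x`, `h' ↦ h`. -/
def sl2Phi [CharZero K] : Sl2 K ≃ₗ[K] Module.Dual K (Sl2 K) :=
  LinearEquiv.ofLinearMap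
    ((sl2Basis K).constr K ![(1 / 2 : K) • (sl2Basis K).coord 1,
      (1 / 2 : K) • (sl2Basis K).coord 0, (sl2Basis K).coord 2])
    ((sl2Basis K).dualBasis.constr K ![(2 : K) • sl2Basis K 1, (2 : K) • sl2Basis K 0,
      sl2Basis K 2])
    (by
      refine (sl2Basis K).dualBasis.ext fun i => ?_
      rw [LinearMap.comp_apply, Module.Basis.constr_basis]
      fin_cases i <;> simp [smul_smul])
    (by
      refine (sl2Basis K).ext fun i => ?_
      rw [LinearMap.comp_apply, Module.Basis.constr_basis]
      simp only [← Module.Basis.coe_dualBasis]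
      fin_cases i <;>
        simp only [Fin.zero_eta, Fin.mk_one, Fin.reduceFinMk, Matrix.cons_val, map_smul,
          Module.Basis.constr_basis, smul_smul, LinearMap.id_apply] <;> norm_num)

/-- The vertex operator Weil algebra of `sl(2,K)`. -/
abbrev W := Weil K (Fin 3)

/-- The operator `Q` for `sl(2,K)`. -/
abbrev slQ : Module.End K (W K) := Q (sl2Basis K)

/-- The operator `h` for `sl(2,K)`. -/
abbrev slh : Module.End K (W K) := koszul K (Fin 3)

/-- The operator `k` for `sl(2,K)`. -/
abbrev slk : Module.End K (W K) := homotopy K (Fin 3)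

/-- The operator `r` for `sl(2,K)`. -/
abbrev slr [CharZero K] : Module.End K (W K) := rOp (sl2Basis K) (sl2Phi K)

/-- The operator `t` for `sl(2,K)`. -/
abbrev slt [CharZero K] : Module.End K (W K) := tOp (sl2Basis K) (sl2Phi K)

/-- The subspace of weight (degree) one. -/
abbrev W1 : Submodule K (W K) := Module.End.eigenspace (L0 K (Fin 3)) 1

/-- The four summands `Ker h ∩ Ker r`, `Ker h ∩ Ker t`, `Ker k ∩ Ker r`, `Ker k ∩ Ker t` of the
subspace of weight one. -/
def summand [CharZero K] : Fin 4 → Submodule K (W K) :=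
  ![W1 K ⊓ (LinearMap.ker (slh K) ⊓ LinearMap.ker (slr K)),
    W1 K ⊓ (LinearMap.ker (slh K) ⊓ LinearMap.ker (slt K)),
    W1 K ⊓ (LinearMap.ker (slk K) ⊓ LinearMap.ker (slr K)),
    W1 K ⊓ (LinearMap.ker (slk K) ⊓ LinearMap.ker (slt K))]

/-- `v^{(3)} = (γ_0^{h'})² + γ_0^{x'} γ_0^{y'}`. -/
def v3 : Module.End K (W K) :=
  mode K .gamma 0 2 * mode K .gamma 0 2 + mode K .gamma 0 0 * mode K .gamma 0 1

/-- `v^{(4)} = γ_0^{h'} γ_{-1}^{h'} + (1/2) γ_0^{x'} γ_{-1}^{y'} + (1/2) γ_0^{y'} γ_{-1}^{x'}`. -/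
def v4 : Module.End K (W K) :=
  mode K .gamma 0 2 * mode K .gamma (-1) 2
    + (1 / 2 : K) • (mode K .gamma 0 0 * mode K .gamma (-1) 1)
    + (1 / 2 : K) • (mode K .gamma 0 1 * mode K .gamma (-1) 0)

/-- `v^{(5)} = β_{-1}^h γ_0^{h'} + β_{-1}^x γ_0^{x'} + β_{-1}^y γ_0^{y'}`. -/
def v5 : Module.End K (W K) :=
  mode K .beta (-1) 2 * mode K .gamma 0 2
    + mode K .beta (-1) 0 * mode K .gamma 0 0
    + mode K .beta (-1) 1 * mode K .gamma 0 1

/-- The state `∑_u γ_0^{u'} b_{-1}^u 1`. -/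
def stateH : W K :=
  ∑ u : Fin 3, mode K .gamma 0 u (mode K .b (-1) u (vac K (Fin 3)))

/-- The state `∑_u γ_0^{φ(u)} c_{-1}^{u'} 1`. -/
def stateR [CharZero K] : W K :=
  ∑ u : Fin 3, ∑ w : Fin 3, sl2Phi K (sl2Basis K u) (sl2Basis K w) •
    mode K .gamma 0 w (mode K .c (-1) u (vac K (Fin 3)))

/-- The four families, in the order of the summands: `{v^{(3)}}^n v^{(4)} 1`, `{v^{(3)}}^n` applied
to the state `∑_u γ_0^{u'} b_{-1}^u 1`, `{v^{(3)}}^n` applied to the state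
`∑_u γ_0^{φ(u)} c_{-1}^{u'} 1`, and `{v^{(3)}}^n v^{(5)} 1`. -/
def family [CharZero K] : Fin 4 → ℕ → W K :=
  ![fun n => (v3 K ^ n) (v4 K (vac K (Fin 3))),
    fun n => (v3 K ^ n) (stateH K),
    fun n => (v3 K ^ n) (stateR K),
    fun n => (v3 K ^ n) (v5 K (vac K (Fin 3)))]

end Sl2

end VOWA

end

noncomputable section

open scoped TensorProduct

namespace VOWA

/-! ### Canonical (anti)commutation relations of the modes, and induction from the vacuum. -/

section CommutationRelations

variable {K : Type*} [Field K] {ι : Type*}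

/-! The operators h, k, r, t are odd superderivations with respect to the modes: each sends a mode
to a multiple of another mode, up to the sign rule, and kills the vacuum. An identity between their
supercommutators therefore only has to be checked on the modes (`weil_induction`). This yields that
all four square to zero, that h and k anticommute with r and t, and that hk + kh = rt + tr = -L_0.
In weight one, where L_0 = 1, the pairs -hk, -kh and -rt, -tr are commuting pairs of complementary
projections, and their four products (`summandProj`) cut out the summands. There -r inverts t and -h
inverts k.

For Q, the trace of ad vanishes on sl(2), so the normal ordering can be dropped and Q is a locally
finite sum of cubic terms `qTerm i j` (`slQ_apply`). The anticommutators of Q with h, k, r, t are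
computed term by term. They do not vanish for each (i, j), but their sums cancel after permuting the
three mode indices i + j, -i, -j, by antisymmetry of the bracket and invariance of φ (`slQ_slh`,
`slQ_slk`, `slQ_slt`, `slQ_slr`). Hence Q preserves the summands.

On the vectors of the first family only three terms of Q act. They commute with the invariant
polynomial v3 and their sum kills v4 (`slQ_family_zero`). The operators t, k, kt carry closedness
over to the other families.

Non-exactness comes from a functional: `cartanCoeff` reads off the coefficient of b_{-1}^h as a
polynomial in γ_0^{h'}. It vanishes on the image of Q (`cartanCoeff_slQ`) and takes the value
X^(2n+1) on the second family. Composing it with h and t handles the other families, and distinct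
monomials are linearly independent. -/

theorem weil_neg_smul (a : K) (w : Weil K ι) : (-a) • w = -(a • w) := neg_smul a w

theorem symMul_comm (g g' : Osc ι) (w : Weil K ι) :
    symMul K g (symMul K g' w) = symMul K g' (symMul K g w) := by
  induction w using TensorProduct.induction_on with
  | zero => simp
  | tmul p e => simp [symMul, mul_left_comm]
  | add x y hx hy => simp only [map_add, hx, hy]

theorem symDer_symMul [DecidableEq (Osc ι)] (g g' : Osc ι) (w : Weil K ι) :
    symDer K g (symMul K g' w) = symMul K g' (symDer K g w) + if g = g' then w else 0 := by
  induction w using TensorProduct.induction_on with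
  | zero => simp
  | tmul p e =>
    simp only [symMul, symDer, LinearMap.rTensor_tmul, LinearMap.mulLeft_apply,
      Derivation.coeFn_coe, Derivation.leibniz, MvPolynomial.pderiv_X, smul_eq_mul,
      TensorProduct.add_tmul, Pi.single_apply, eq_comm (a := g)]
    split_ifs <;> simp
  | add x y hx hy =>
    simp only [map_add, hx, hy]
    split_ifs <;> abel

theorem extMul_comm (g g' : Osc ι) (w : Weil K ι) :
    extMul K g (extMul K g' w) = -extMul K g' (extMul K g w) := by
  induction w using TensorProduct.induction_on with
  | zero => simp
  | tmul p e =>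
    simp only [extMul, LinearMap.lTensor_tmul, LinearMap.mulLeft_apply, ← mul_assoc]
    rw [← TensorProduct.tmul_neg, ← neg_mul]
    congr 2
    exact eq_neg_of_add_eq_zero_left (ExteriorAlgebra.ι_add_mul_swap _ _)
  | add x y hx hy => simp only [map_add, hx, hy, neg_add]

theorem extDer_extMul [DecidableEq (Osc ι)] (g g' : Osc ι) (w : Weil K ι) :
    extDer K g (extMul K g' w) = -extMul K g' (extDer K g w) + if g = g' then w else 0 := by
  induction w using TensorProduct.induction_on with
  | zero => simp
  | tmul p e =>
    simp only [extMul, extDer, LinearMap.lTensor_tmul, LinearMap.mulLeft_apply,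
      ExteriorAlgebra.ι, CliffordAlgebra.contractLeft_ι_mul, TensorProduct.tmul_sub,
      Finsupp.lapply_apply, Finsupp.single_apply, eq_comm (a := g)]
    split_ifs <;> simp [sub_eq_neg_add]
  | add x y hx hy =>
    simp only [map_add, hx, hy]
    split_ifs <;> abel

theorem symMul_extMul (g g' : Osc ι) (w : Weil K ι) :
    symMul K g (extMul K g' w) = extMul K g' (symMul K g w) := by
  simp only [symMul, extMul, ← LinearMap.comp_apply, LinearMap.rTensor_comp_lTensor,
    LinearMap.lTensor_comp_rTensor]

theorem symMul_extDer (g g' : Osc ι) (w : Weil K ι) :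
    symMul K g (extDer K g' w) = extDer K g' (symMul K g w) := by
  simp only [symMul, extDer, ← LinearMap.comp_apply, LinearMap.rTensor_comp_lTensor,
    LinearMap.lTensor_comp_rTensor]

theorem symDer_extMul (g g' : Osc ι) (w : Weil K ι) :
    symDer K g (extMul K g' w) = extMul K g' (symDer K g w) := by
  simp only [symDer, extMul, ← LinearMap.comp_apply, LinearMap.rTensor_comp_lTensor,
    LinearMap.lTensor_comp_rTensor]

/-- An even and an odd mode commute. -/
theorem mode_comm_of_even_odd {s s' : Kind} (hs : s.odd = false) (hs' : s'.odd = true) (n m : ℤ)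
    (i j : ι) (w : Weil K ι) :
    mode K s n i (mode K s' m j w) = mode K s' m j (mode K s n i w) := by
  cases s <;> simp only [Kind.odd, reduceCtorEq] at hs <;>
  cases s' <;> simp only [Kind.odd, reduceCtorEq] at hs' <;>
  rcases n with (_ | n) | n <;> rcases m with (_ | m) | m <;>
  simp [mode, symMul_extMul, symMul_extDer, symDer_extMul, symDer_extDer]

theorem beta_beta (n m : ℤ) (i j : ι) (w : Weil K ι) :
    mode K .beta n i (mode K .beta m j w) = mode K .beta m j (mode K .beta n i w) := by
  classical
  rcases n with n | n <;> rcases m with m | m <;>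
  simp [mode, symMul_comm (.low i n), symDer_symMul, symDer_comm (.up i n)]

theorem gamma_gamma (n m : ℤ) (i j : ι) (w : Weil K ι) :
    mode K .gamma n i (mode K .gamma m j w) = mode K .gamma m j (mode K .gamma n i w) := by
  classical
  rcases n with (_ | n) | n <;> rcases m with (_ | m) | m <;>
  simp [mode, symMul_comm (.up i _), symDer_symMul, symDer_comm (.low i _)]

theorem b_b (n m : ℤ) (i j : ι) (w : Weil K ι) :
    mode K .b n i (mode K .b m j w) = -mode K .b m j (mode K .b n i w) := by
  classical
  rcases n with n | n <;> rcases m with m | m <;>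
  simp [mode, extMul_comm (.low i n), extDer_extMul, extDer_comm (.up i n)]

theorem c_c (n m : ℤ) (i j : ι) (w : Weil K ι) :
    mode K .c n i (mode K .c m j w) = -mode K .c m j (mode K .c n i w) := by
  classical
  rcases n with (_ | n) | n <;> rcases m with (_ | m) | m <;>
  simp [mode, extMul_comm (.up i _), extDer_extMul, extDer_comm (.low i _)]

/-- A contraction arises only when exactly one of the two modes is an annihilator. The minus sign in
the definition of β_n for n ≥ 0 makes it +1 in both situations. The auxiliary equivalences translate
n + m = 0 into equality of oscillator labels, where `low i n` is the mode -n-1. -/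
theorem gamma_beta [DecidableEq ι] (n m : ℤ) (i j : ι) (w : Weil K ι) :
    mode K .gamma n i (mode K .beta m j w) = mode K .beta m j (mode K .gamma n i w) +
      if i = j ∧ n + m = 0 then w else 0 := by
  classical
  rcases n with (_ | n) | n <;> rcases m with m | m
  · have : (j = i ∧ m = 0) ↔ (i = j ∧ (Int.ofNat 0 + Int.ofNat m) = 0) := by simp [eq_comm]
    rw [if_congr this.symm (rfl : w = w) rfl]
    simp [mode, symDer_symMul]
  · have : ¬(i = j ∧ (Int.ofNat 0 + Int.negSucc m) = 0) := by rintro ⟨_, h⟩; simp at h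
    rw [if_neg this]
    simp [mode, symMul_comm (.up i _)]
  · have : ¬(i = j ∧ (Int.ofNat (n + 1) + Int.ofNat m) = 0) := by rintro ⟨_, h⟩; simp at h; omega
    rw [if_neg this]
    simp [mode, symDer_comm (.low i n)]
  · have : (i = j ∧ n = m) ↔ (i = j ∧ (Int.ofNat (n + 1) + Int.negSucc m) = 0) := by
      refine and_congr_right fun _ => ?_
      simp only [Int.ofNat_eq_natCast, Int.negSucc_eq]; omega
    rw [if_congr this.symm (rfl : w = w) rfl]
    simp [mode, symDer_symMul]
  · have : (j = i ∧ m = n + 1) ↔ (i = j ∧ (Int.negSucc n + Int.ofNat m) = 0) := by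
      refine and_congr eq_comm ?_
      simp only [Int.ofNat_eq_natCast, Int.negSucc_eq]; omega
    rw [if_congr this.symm (rfl : w = w) rfl]
    simp [mode, symDer_symMul]
  · have : ¬(i = j ∧ (Int.negSucc n + Int.negSucc m) = 0) := by
      rintro ⟨_, h⟩; simp only [Int.negSucc_eq] at h; omega
    rw [if_neg this]
    simp [mode, symMul_comm (.up i _)]

theorem c_b [DecidableEq ι] (n m : ℤ) (i j : ι) (w : Weil K ι) :
    mode K .c n i (mode K .b m j w) = -mode K .b m j (mode K .c n i w) +
      if i = j ∧ n + m = 0 then w else 0 := by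
  classical
  rcases n with (_ | n) | n <;> rcases m with m | m
  · have : (j = i ∧ m = 0) ↔ (i = j ∧ (Int.ofNat 0 + Int.ofNat m) = 0) := by simp [eq_comm]
    rw [if_congr this.symm (rfl : w = w) rfl]
    simp [mode, extDer_extMul]
  · have : ¬(i = j ∧ (Int.ofNat 0 + Int.negSucc m) = 0) := by rintro ⟨_, h⟩; simp at h
    rw [if_neg this]
    simp [mode, extMul_comm (.up i _)]
  · have : ¬(i = j ∧ (Int.ofNat (n + 1) + Int.ofNat m) = 0) := by rintro ⟨_, h⟩; simp at h; omega
    rw [if_neg this]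
    simp [mode, extDer_comm (.low i n)]
  · have : (i = j ∧ n = m) ↔ (i = j ∧ (Int.ofNat (n + 1) + Int.negSucc m) = 0) := by
      refine and_congr_right fun _ => ?_
      simp only [Int.ofNat_eq_natCast, Int.negSucc_eq]; omega
    rw [if_congr this.symm (rfl : w = w) rfl]
    simp [mode, extDer_extMul]
  · have : (j = i ∧ m = n + 1) ↔ (i = j ∧ (Int.negSucc n + Int.ofNat m) = 0) := by
      refine and_congr eq_comm ?_
      simp only [Int.ofNat_eq_natCast, Int.negSucc_eq]; omega
    rw [if_congr this.symm (rfl : w = w) rfl]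
    simp [mode, extDer_extMul]
  · have : ¬(i = j ∧ (Int.negSucc n + Int.negSucc m) = 0) := by
      rintro ⟨_, h⟩; simp only [Int.negSucc_eq] at h; omega
    rw [if_neg this]
    simp [mode, extMul_comm (.up i _)]

theorem beta_gamma [DecidableEq ι] (n m : ℤ) (i j : ι) (w : Weil K ι) :
    mode K .beta n i (mode K .gamma m j w) = mode K .gamma m j (mode K .beta n i w) -
      if j = i ∧ m + n = 0 then w else 0 := by
  rw [gamma_beta, add_sub_cancel_right]

theorem b_c [DecidableEq ι] (n m : ℤ) (i j : ι) (w : Weil K ι) :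
    mode K .b n i (mode K .c m j w) = -mode K .c m j (mode K .b n i w) +
      if j = i ∧ m + n = 0 then w else 0 := by
  rw [c_b]; abel

theorem beta_b (n m : ℤ) (i j : ι) (w : Weil K ι) :
    mode K .beta n i (mode K .b m j w) = mode K .b m j (mode K .beta n i w) :=
  mode_comm_of_even_odd rfl rfl n m i j w

theorem beta_c (n m : ℤ) (i j : ι) (w : Weil K ι) :
    mode K .beta n i (mode K .c m j w) = mode K .c m j (mode K .beta n i w) :=
  mode_comm_of_even_odd rfl rfl n m i j w

theorem gamma_b (n m : ℤ) (i j : ι) (w : Weil K ι) :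
    mode K .gamma n i (mode K .b m j w) = mode K .b m j (mode K .gamma n i w) :=
  mode_comm_of_even_odd rfl rfl n m i j w

theorem gamma_c (n m : ℤ) (i j : ι) (w : Weil K ι) :
    mode K .gamma n i (mode K .c m j w) = mode K .c m j (mode K .gamma n i w) :=
  mode_comm_of_even_odd rfl rfl n m i j w

/-- Annihilation operators kill the vacuum. -/
theorem mode_vac {s : Kind} {n : ℤ} (i : ι) (h : s.creation n = false) :
    mode K s n i (vac K ι) = 0 := by
  obtain ⟨g, _, h | h | h⟩ := mode_annihilation (K := K) s n i h <;>
    simp [h, vac, symDer, extDer]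

/-- A property which is linear, holds for the vacuum and is preserved by all modes holds for
all vectors. -/
theorem weil_induction {P : Weil K ι → Prop} (hv : P (vac K ι))
    (hadd : ∀ v w, P v → P w → P (v + w)) (hsmul : ∀ (a : K) w, P w → P (a • w))
    (hmode : ∀ s n i w, P w → P (mode K s n i w)) (w : Weil K ι) : P w := by
  have hz : P 0 := by simpa using hsmul 0 _ hv
  have hsym : ∀ g w, P w → P (symMul K g w) := by
    rintro (⟨i, n⟩ | ⟨i, n⟩) w hw
    · exact hmode .beta (.negSucc n) i w hw
    · cases n with
      | zero => exact hmode .gamma (.ofNat 0) i w hw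
      | succ n => exact hmode .gamma (.negSucc n) i w hw
  have hext : ∀ g w, P w → P (extMul K g w) := by
    rintro (⟨i, n⟩ | ⟨i, n⟩) w hw
    · exact hmode .b (.negSucc n) i w hw
    · cases n with
      | zero => exact hmode .c (.ofNat 0) i w hw
      | succ n => exact hmode .c (.negSucc n) i w hw
  induction w using TensorProduct.induction_on with
  | zero => exact hz
  | add v w hv hw => exact hadd v w hv hw
  | tmul p e =>
    induction p using MvPolynomial.induction_on with
    | add p q hp hq => rw [TensorProduct.add_tmul]; exact hadd _ _ hp hq
    | mul_X p g hp =>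
      have := hsym g _ hp
      rwa [symMul, LinearMap.rTensor_tmul, LinearMap.mulLeft_apply, mul_comm] at this
    | C a =>
      rw [← mul_one (MvPolynomial.C a), ← MvPolynomial.smul_eq_C_mul, ← TensorProduct.smul_tmul']
      refine hsmul a _ ?_
      induction e using CliffordAlgebra.left_induction with
      | algebraMap r =>
        rw [Algebra.algebraMap_eq_smul_one, TensorProduct.tmul_smul]
        exact hsmul r _ hv
      | add x y hx hy => rw [TensorProduct.tmul_add]; exact hadd _ _ hx hy
      | ι_mul x m hx =>
        induction m using Finsupp.induction_linear with
        | zero => simpa using hz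
        | add f g hf hg =>
          rw [map_add, add_mul, TensorProduct.tmul_add]; exact hadd _ _ hf hg
        | single g c =>
          have := hsmul c _ (hext g _ hx)
          rw [extMul, LinearMap.lTensor_tmul, LinearMap.mulLeft_apply, ← TensorProduct.tmul_smul,
            ← smul_mul_assoc, ← map_smul, Finsupp.smul_single, smul_eq_mul, mul_one] at this
          exact this

end CommutationRelations

/-! ### Commutators of the quadratic operators with single modes. -/

section Quadratic

variable {K : Type*} [Field K] {ι : Type*}

/-- If all but one of the summands of a locally finite sum supercommute with `X`, then the
supercommutator of the sum with `X` comes from the remaining summand. -/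
theorem locSum_apply_of_single {I : Type*} (T : I → Module.End K (Weil K ι))
    (hT : ∀ w, (Function.support fun a => T a w).Finite) (X : Module.End K (Weil K ι)) (e : K)
    (w : Weil K ι) (R : I → Weil K ι) (a₀ : I) (h : ∀ a, T a (X w) = e • X (T a w) + R a)
    (hR : ∀ a, a ≠ a₀ → R a = 0) :
    locSum T hT (X w) = e • X (locSum T hT w) + R a₀ := by
  have h1 : (Function.support fun a => e • X (T a w)).Finite :=
    (hT w).subset fun a ha h0 => ha (by simp [show T a w = 0 from h0])
  have h2 : (Function.support R).Finite :=
    (Set.finite_singleton a₀).subset fun a ha => by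
      by_contra hne
      exact ha (hR a hne)
  change ∑ᶠ a, T a (X w) = e • X (∑ᶠ a, T a w) + R a₀
  simp only [h]
  rw [finsum_add_distrib h1 h2, finsum_eq_single R a₀ hR, ← LinearMap.smul_apply,
    map_finsum (e • X) (hT w)]
  rfl

/-- Source of all the commutators with modes: `e` is 1 or -1 according to the parities, `R` records
the contractions with `X`, and `a₀` is the only index at which a contraction can be nonzero. -/
theorem nordSum_apply_of_single {I J : Type*} [Fintype J] {coef : I → J → K}
    {l : I → J → List (Kind × ℤ × ι)}
    {hl : ∀ N : ℤ, {a | ∃ j, ∀ x ∈ l a j, x.2.1 ≤ N}.Finite} (X : Module.End K (Weil K ι)) (e : K)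
    (w : Weil K ι) (R : I → Weil K ι) (a₀ : I)
    (h : ∀ a, (∑ j, coef a j • nord K (l a j)) (X w) =
      e • X ((∑ j, coef a j • nord K (l a j)) w) + R a)
    (hR : ∀ a, a ≠ a₀ → R a = 0) :
    nordSum coef l hl (X w) = e • X (nordSum coef l hl w) + R a₀ :=
  locSum_apply_of_single _ _ X e w R a₀ h hR

theorem nordSum_eq_zero {I J : Type*} [Fintype J] {coef : I → J → K}
    {l : I → J → List (Kind × ℤ × ι)}
    {hl : ∀ N : ℤ, {a | ∃ j, ∀ x ∈ l a j, x.2.1 ≤ N}.Finite} {w : Weil K ι}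
    (h : ∀ a j, coef a j • nord K (l a j) w = 0) :
    nordSum coef l hl w = 0 := by
  change ∑ᶠ a, (∑ j, coef a j • nord K (l a j)) w = 0
  simp [h]

/-- An even and an odd mode commute, so their normal ordering is the plain product whatever the
indices. -/
theorem nord_pair_of_even_odd {s s' : Kind} (hs : s.odd = false) (hs' : s'.odd = true) (n m : ℤ)
    (i j : ι) (w : Weil K ι) :
    nord K [(s, n, i), (s', m, j)] w = mode K s n i (mode K s' m j w) := by
  by_cases h : s.creation n <;> by_cases h' : s'.creation m <;>
    simp [nord, hs, hs', h, h', mode_comm_of_even_odd hs hs']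

theorem nord_gamma_b (n m : ℤ) (i j : ι) (w : Weil K ι) :
    nord K [(.gamma, n, i), (.b, m, j)] w = mode K .gamma n i (mode K .b m j w) :=
  nord_pair_of_even_odd rfl rfl n m i j w

theorem nord_beta_b (n m : ℤ) (i j : ι) (w : Weil K ι) :
    nord K [(.beta, n, i), (.b, m, j)] w = mode K .beta n i (mode K .b m j w) :=
  nord_pair_of_even_odd rfl rfl n m i j w

theorem nord_beta_c (n m : ℤ) (i j : ι) (w : Weil K ι) :
    nord K [(.beta, n, i), (.c, m, j)] w = mode K .beta n i (mode K .c m j w) :=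
  nord_pair_of_even_odd rfl rfl n m i j w

theorem nord_gamma_c (n m : ℤ) (i j : ι) (w : Weil K ι) :
    nord K [(.gamma, n, i), (.c, m, j)] w = mode K .gamma n i (mode K .c m j w) :=
  nord_pair_of_even_odd rfl rfl n m i j w

theorem nord_b_c (n m : ℤ) (i j : ι) (w : Weil K ι) :
    nord K [(.b, n, i), (.c, m, j)] w =
      if n ≤ -1 then mode K .b n i (mode K .c m j w) else -mode K .c m j (mode K .b n i w) := by
  by_cases h : n ≤ -1 <;> simp [nord, Kind.creation, Kind.odd, h]

theorem nord_beta_gamma (n m : ℤ) (i j : ι) (w : Weil K ι) :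
    nord K [(.beta, n, i), (.gamma, m, j)] w =
      if n ≤ -1 then mode K .beta n i (mode K .gamma m j w)
      else mode K .gamma m j (mode K .beta n i w) := by
  by_cases h : n ≤ -1 <;> simp [nord, Kind.creation, Kind.odd, h]

variable [Fintype ι]

/-! #### The Koszul differential -/

theorem koszul_gamma (m : ℤ) (j : ι) (w : Weil K ι) :
    koszul K ι (mode K .gamma m j w) =
      mode K .gamma m j (koszul K ι w) := by
  classical
  refine (nordSum_apply_of_single (mode K .gamma m j) 1 w (fun _ => 0) (j, 0) (fun a => ?_)
    (fun a _ => rfl)).trans (by simp [koszul])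
  simp [nord_gamma_b, gamma_b, gamma_gamma m]

theorem koszul_b (m : ℤ) (j : ι) (w : Weil K ι) :
    koszul K ι (mode K .b m j w) =
      -mode K .b m j (koszul K ι w) := by
  classical
  refine (nordSum_apply_of_single (mode K .b m j) (-1) w (fun _ => 0) (j, 0) (fun a => ?_)
    (fun a _ => rfl)).trans (by simp [koszul, weil_neg_smul])
  simp [nord_gamma_b, gamma_b, b_b m]

theorem koszul_beta (m : ℤ) (j : ι) (w : Weil K ι) :
    koszul K ι (mode K .beta m j w) =
      mode K .beta m j (koszul K ι w) + mode K .b m j w := by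
  classical
  refine (nordSum_apply_of_single (mode K .beta m j) 1 w
    (fun a => if a.1 = j ∧ -a.2 + m = 0 then mode K .b a.2 a.1 w else 0)
    (j, m) (fun a => ?_) (fun a ha => if_neg ?_)).trans
    (by simp [koszul])
  · simp only [Finset.univ_unique, Finset.sum_const, Finset.card_singleton, one_smul,
      nord_gamma_b, beta_b, gamma_b, gamma_beta, map_add, apply_ite (mode K .b a.2 a.1), map_zero]
  · rintro ⟨h, h'⟩
    exact ha (Prod.ext h (by dsimp; omega))

theorem koszul_c (m : ℤ) (j : ι) (w : Weil K ι) :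
    koszul K ι (mode K .c m j w) =
      -mode K .c m j (koszul K ι w) + mode K .gamma m j w := by
  classical
  refine (nordSum_apply_of_single (mode K .c m j) (-1) w
    (fun a => if j = a.1 ∧ m + a.2 = 0 then mode K .gamma (-a.2) a.1 w else 0)
    (j, -m) (fun a => ?_) (fun a ha => if_neg ?_)).trans
    (by simp [koszul, weil_neg_smul])
  · simp only [Finset.univ_unique, Finset.sum_const, Finset.card_singleton, one_smul,
      nord_gamma_b, b_c, gamma_c, map_add, map_neg, apply_ite (mode K .gamma _ _), map_zero,
      weil_neg_smul, one_smul]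
  · rintro ⟨h, h'⟩
    exact ha (Prod.ext h.symm (by dsimp; omega))

/-- In each summand one of two commuting factors annihilates the vacuum: γ_{-n} if n ≤ -1, and b_n
if n ≥ 0. -/
theorem koszul_vac : koszul K ι (vac K ι) = 0 := by
  refine nordSum_eq_zero fun a _ => ?_
  by_cases h : a.2 ≤ -1
  · simp [nord_gamma_b, gamma_b, mode_vac (K := K) (s := .gamma) (n := -a.2) a.1
      (by simp [Kind.creation]; omega)]
  · simp [nord_gamma_b, mode_vac (K := K) (s := .b) (n := a.2) a.1
      (by simp [Kind.creation]; omega)]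

/-! #### The homotopy operator -/

theorem homotopy_beta (m : ℤ) (j : ι) (w : Weil K ι) :
    homotopy K ι (mode K .beta m j w) =
      mode K .beta m j (homotopy K ι w) := by
  classical
  refine (nordSum_apply_of_single (mode K .beta m j) 1 w (fun _ => 0) (j, 0) (fun a => ?_)
    (fun a _ => rfl)).trans (by simp [homotopy])
  simp [nord_beta_c, beta_c, beta_beta m]

theorem homotopy_c (m : ℤ) (j : ι) (w : Weil K ι) :
    homotopy K ι (mode K .c m j w) =
      -mode K .c m j (homotopy K ι w) := by
  classical
  refine (nordSum_apply_of_single (mode K .c m j) (-1) w (fun _ => 0) (j, 0) (fun a => ?_)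
    (fun a _ => rfl)).trans (by simp [homotopy, weil_neg_smul])
  simp [nord_beta_c, beta_c, c_c m]

theorem homotopy_gamma (m : ℤ) (j : ι) (w : Weil K ι) :
    homotopy K ι (mode K .gamma m j w) =
      mode K .gamma m j (homotopy K ι w) + (m : K) • mode K .c m j w := by
  classical
  -- The contracted summand has n = -m, and the contraction of β with γ contributes another sign,
  -- which gives the coefficient m.
  refine (nordSum_apply_of_single (mode K .gamma m j) 1 w
    (fun a => if j = a.1 ∧ m + a.2 = 0 then (-a.2 : K) • mode K .c (-a.2) a.1 w else 0)
    (j, -m) (fun a => ?_) (fun a ha => if_neg ?_)).trans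
    (by simp [homotopy])
  · simp only [Finset.univ_unique, Finset.sum_const, Finset.card_singleton, one_smul,
      LinearMap.smul_apply, nord_beta_c, beta_gamma, beta_c, gamma_c, map_sub,
      apply_ite (mode K .c _ _), map_zero, map_smul]
    split_ifs <;> simp [sub_eq_add_neg, weil_neg_smul]
  · rintro ⟨h, h'⟩
    exact ha (Prod.ext h.symm (by dsimp; omega))

theorem homotopy_b (m : ℤ) (j : ι) (w : Weil K ι) :
    homotopy K ι (mode K .b m j w) =
      -mode K .b m j (homotopy K ι w) + (m : K) • mode K .beta m j w := by
  classical
  refine (nordSum_apply_of_single (mode K .b m j) (-1) w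
    (fun a => if a.1 = j ∧ -a.2 + m = 0 then (a.2 : K) • mode K .beta a.2 a.1 w else 0)
    (j, m) (fun a => ?_) (fun a ha => if_neg ?_)).trans
    (by simp [homotopy, weil_neg_smul])
  · simp only [Finset.univ_unique, Finset.sum_const, Finset.card_singleton, one_smul,
      LinearMap.smul_apply, nord_beta_c, c_b, beta_b, map_add, map_neg,
      apply_ite (mode K .beta _ _), map_zero, map_smul, weil_neg_smul, one_smul]
    split_ifs <;> simp
  · rintro ⟨h, h'⟩
    exact ha (Prod.ext h (by dsimp; omega))

theorem homotopy_vac : homotopy K ι (vac K ι) = 0 := by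
  refine nordSum_eq_zero fun a _ => ?_
  by_cases h : a.2 ≤ -1
  · simp [nord_beta_c, mode_vac (K := K) (s := .c) (n := -a.2) a.1
      (by simp [Kind.creation]; omega)]
  · simp [nord_beta_c, beta_c, mode_vac (K := K) (s := .beta) (n := a.2) a.1
      (by simp [Kind.creation]; omega)]

/-! #### The weight operator -/

/-- The odd part `∑_{u,m} m :b_m^u c_{-m}^{u'}:` of `-L_0`. -/
def weightExt (K : Type*) [Field K] (ι : Type*) [Fintype ι] : Module.End K (Weil K ι) :=
  nordSum (fun (a : ι × ℤ) (_ : Unit) => (a.2 : K))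
      (fun a _ => [(.b, a.2, a.1), (.c, -a.2, a.1)])
      (fun N => finite_pairs (A := -N) (B := N) fun a ha => by
        simp at ha; omega)

/-- The even part `∑_{u,m} m :β_m^u γ_{-m}^{u'}:` of `-L_0`. -/
def weightSym (K : Type*) [Field K] (ι : Type*) [Fintype ι] : Module.End K (Weil K ι) :=
  nordSum (fun (a : ι × ℤ) (_ : Unit) => (a.2 : K))
      (fun a _ => [(.beta, a.2, a.1), (.gamma, -a.2, a.1)])
      (fun N => finite_pairs (A := -N) (B := N) fun a ha => by
        simp at ha; omega)

theorem L0_apply (w : Weil K ι) : L0 K ι w = -weightExt K ι w - weightSym K ι w := rfl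

theorem weightExt_beta (m : ℤ) (j : ι) (w : Weil K ι) :
    weightExt K ι (mode K .beta m j w) =
      mode K .beta m j (weightExt K ι w) := by
  classical
  refine (nordSum_apply_of_single (mode K .beta m j) 1 w (fun _ => 0) (j, 0) (fun a => ?_)
    (fun a _ => rfl)).trans (by simp [weightExt])
  simp only [Finset.univ_unique, Finset.sum_const, Finset.card_singleton, one_smul,
      LinearMap.smul_apply, nord_b_c, ← beta_c m, ← beta_b m, map_smul, add_zero]
  split_ifs <;> simp

theorem weightExt_gamma (m : ℤ) (j : ι) (w : Weil K ι) :
    weightExt K ι (mode K .gamma m j w) =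
      mode K .gamma m j (weightExt K ι w) := by
  classical
  refine (nordSum_apply_of_single (mode K .gamma m j) 1 w (fun _ => 0) (j, 0) (fun a => ?_)
    (fun a _ => rfl)).trans (by simp [weightExt])
  simp only [Finset.univ_unique, Finset.sum_const, Finset.card_singleton, one_smul,
      LinearMap.smul_apply, nord_b_c, ← gamma_c m, ← gamma_b m, map_smul, add_zero]
  split_ifs <;> simp

theorem weightExt_b (m : ℤ) (j : ι) (w : Weil K ι) :
    weightExt K ι (mode K .b m j w) =
      mode K .b m j (weightExt K ι w) + (m : K) • mode K .b m j w := by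
  classical
  refine (nordSum_apply_of_single (mode K .b m j) 1 w
    (fun a => if a.1 = j ∧ -a.2 + m = 0 then (a.2 : K) • mode K .b a.2 a.1 w else 0)
    (j, m) (fun a => ?_) (fun a ha => if_neg ?_)).trans
    (by simp [weightExt])
  · simp only [Finset.univ_unique, Finset.sum_const, Finset.card_singleton, one_smul,
      LinearMap.smul_apply, nord_b_c, c_b, map_add, b_b a.2 m, map_neg,
      apply_ite (mode K .b _ _), map_zero, map_smul]
    split_ifs <;> simp
  · rintro ⟨h, h'⟩
    exact ha (Prod.ext h (by dsimp; omega))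

theorem weightExt_c (m : ℤ) (j : ι) (w : Weil K ι) :
    weightExt K ι (mode K .c m j w) =
      mode K .c m j (weightExt K ι w) + (m : K) • mode K .c m j w := by
  classical
  refine (nordSum_apply_of_single (mode K .c m j) 1 w
    (fun a => if j = a.1 ∧ m + a.2 = 0 then -((a.2 : K) • mode K .c (-a.2) a.1 w) else 0)
    (j, -m) (fun a => ?_) (fun a ha => if_neg ?_)).trans
    (by simp [weightExt, weil_neg_smul])
  · simp only [Finset.univ_unique, Finset.sum_const, Finset.card_singleton, one_smul,
      LinearMap.smul_apply, nord_b_c, b_c, map_add, c_c (-a.2) m, map_neg,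
      apply_ite (mode K .c _ _), map_zero, map_smul]
    split_ifs <;> simp <;> abel
  · rintro ⟨h, h'⟩
    exact ha (Prod.ext h.symm (by dsimp; omega))

theorem weightExt_vac : weightExt K ι (vac K ι) = 0 := by
  refine nordSum_eq_zero fun a _ => ?_
  by_cases h : a.2 ≤ -1
  · simp [nord_b_c, h, mode_vac (K := K) (s := .c) (n := -a.2) a.1
      (by simp [Kind.creation]; omega)]
  · simp [nord_b_c, h, mode_vac (K := K) (s := .b) (n := a.2) a.1
      (by simp [Kind.creation]; omega)]

theorem weightSym_b (m : ℤ) (j : ι) (w : Weil K ι) :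
    weightSym K ι (mode K .b m j w) =
      mode K .b m j (weightSym K ι w) := by
  classical
  refine (nordSum_apply_of_single (mode K .b m j) 1 w (fun _ => 0) (j, 0) (fun a => ?_)
    (fun a _ => rfl)).trans (by simp [weightSym])
  simp only [Finset.univ_unique, Finset.sum_const, Finset.card_singleton, one_smul,
      LinearMap.smul_apply, nord_beta_gamma, beta_b, gamma_b, map_smul, add_zero]
  split_ifs <;> simp

theorem weightSym_c (m : ℤ) (j : ι) (w : Weil K ι) :
    weightSym K ι (mode K .c m j w) =
      mode K .c m j (weightSym K ι w) := by
  classical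
  refine (nordSum_apply_of_single (mode K .c m j) 1 w (fun _ => 0) (j, 0) (fun a => ?_)
    (fun a _ => rfl)).trans (by simp [weightSym])
  simp only [Finset.univ_unique, Finset.sum_const, Finset.card_singleton, one_smul,
      LinearMap.smul_apply, nord_beta_gamma, beta_c, gamma_c, map_smul, add_zero]
  split_ifs <;> simp

theorem weightSym_beta (m : ℤ) (j : ι) (w : Weil K ι) :
    weightSym K ι (mode K .beta m j w) =
      mode K .beta m j (weightSym K ι w) + (m : K) • mode K .beta m j w := by
  classical
  refine (nordSum_apply_of_single (mode K .beta m j) 1 w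
    (fun a => if a.1 = j ∧ -a.2 + m = 0 then (a.2 : K) • mode K .beta a.2 a.1 w else 0)
    (j, m) (fun a => ?_) (fun a ha => if_neg ?_)).trans
    (by simp [weightSym])
  · simp only [Finset.univ_unique, Finset.sum_const, Finset.card_singleton, one_smul,
      LinearMap.smul_apply, nord_beta_gamma, gamma_beta, map_add, beta_beta a.2 m,
      apply_ite (mode K .beta _ _), map_zero, map_smul]
    split_ifs <;> simp
  · rintro ⟨h, h'⟩
    exact ha (Prod.ext h (by dsimp; omega))

theorem weightSym_gamma (m : ℤ) (j : ι) (w : Weil K ι) :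
    weightSym K ι (mode K .gamma m j w) =
      mode K .gamma m j (weightSym K ι w) + (m : K) • mode K .gamma m j w := by
  classical
  refine (nordSum_apply_of_single (mode K .gamma m j) 1 w
    (fun a => if j = a.1 ∧ m + a.2 = 0 then -((a.2 : K) • mode K .gamma (-a.2) a.1 w) else 0)
    (j, -m) (fun a => ?_) (fun a ha => if_neg ?_)).trans
    (by simp [weightSym, weil_neg_smul])
  · simp only [Finset.univ_unique, Finset.sum_const, Finset.card_singleton, one_smul,
      LinearMap.smul_apply, nord_beta_gamma, beta_gamma, map_sub, gamma_gamma (-a.2) m,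
      apply_ite (mode K .gamma _ _), map_zero, map_smul]
    split_ifs <;> simp [sub_eq_add_neg]
  · rintro ⟨h, h'⟩
    exact ha (Prod.ext h.symm (by dsimp; omega))

theorem weightSym_vac : weightSym K ι (vac K ι) = 0 := by
  refine nordSum_eq_zero fun a _ => ?_
  by_cases h : a.2 ≤ -1
  · simp [nord_beta_gamma, h, mode_vac (K := K) (s := .gamma) (n := -a.2) a.1
      (by simp [Kind.creation]; omega)]
  · simp [nord_beta_gamma, h, mode_vac (K := K) (s := .beta) (n := a.2) a.1
      (by simp [Kind.creation]; omega)]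

/-- A mode of index m has weight -m. Its contraction takes place in only one of the two halves of
L_0. -/
theorem L0_mode (s : Kind) (m : ℤ) (j : ι) (w : Weil K ι) :
    L0 K ι (mode K s m j w) = mode K s m j (L0 K ι w) - (m : K) • mode K s m j w := by
  cases s <;>
  simp only [L0_apply, weightExt_b, weightExt_c, weightExt_beta, weightExt_gamma, weightSym_b,
    weightSym_c, weightSym_beta, weightSym_gamma, map_sub, map_neg] <;> abel

theorem L0_vac : L0 K ι (vac K ι) = 0 := by
  simp [L0_apply, weightExt_vac, weightSym_vac]

end Quadratic

/-! ### The operators r and t for sl(2) and their commutators with modes. -/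

section Sl2Operators

variable {K : Type*} [Field K]

/-- The permutation of the basis `x, y, h` underlying `φ`. -/
def sl2Swap : Fin 3 → Fin 3 := ![1, 0, 2]

/-- The coefficients of `φ`: `φ(u) = κ_u σ(u)'`. -/
def sl2Scale (K : Type*) [Field K] : Fin 3 → K := ![1 / 2, 1 / 2, 1]

theorem sl2Swap_swap (u : Fin 3) : sl2Swap (sl2Swap u) = u := by
  fin_cases u <;> rfl

theorem sl2Swap_eq_iff (u v : Fin 3) : sl2Swap u = v ↔ u = sl2Swap v := by
  constructor <;> rintro rfl <;> simp [sl2Swap_swap]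

/-- This is the symmetry of the bilinear form given by φ. -/
theorem sl2Scale_swap (u : Fin 3) : sl2Scale K (sl2Swap u) = sl2Scale K u := by
  fin_cases u <;> rfl

variable [CharZero K]

theorem sl2Scale_ne_zero (u : Fin 3) : sl2Scale K u ≠ 0 := by
  fin_cases u <;> simp [sl2Scale]

theorem sl2Phi_basis (u : Fin 3) :
    sl2Phi K (sl2Basis K u) = sl2Scale K u • (sl2Basis K).coord (sl2Swap u) := by
  change (sl2Basis K).constr K _ (sl2Basis K u) = _
  rw [Module.Basis.constr_basis]
  fin_cases u <;> simp [sl2Scale, sl2Swap]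

theorem sl2Phi_apply (u w : Fin 3) :
    sl2Phi K (sl2Basis K u) (sl2Basis K w) = if w = sl2Swap u then sl2Scale K u else 0 := by
  simp [sl2Phi_basis, Finsupp.single_apply]

theorem sl2Phi_symm_coord (u w : Fin 3) :
    (sl2Basis K).repr ((sl2Phi K).symm ((sl2Basis K).coord u)) w =
      if w = sl2Swap u then (sl2Scale K u)⁻¹ else 0 := by
  have h : (sl2Phi K).symm ((sl2Basis K).coord u) =
      (sl2Scale K u)⁻¹ • sl2Basis K (sl2Swap u) := by
    rw [LinearEquiv.symm_apply_eq, map_smul, sl2Phi_basis, sl2Swap_swap, sl2Scale_swap, smul_smul,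
      inv_mul_cancel₀ (sl2Scale_ne_zero u), one_smul]
  simp [h, Finsupp.single_apply, eq_comm]

/-- φ takes each basis vector to a multiple of a single dual basis vector, so the inner sum
collapses and r gets the same shape as h and k. -/
theorem slr_summand (a : Fin 3 × ℤ) (v : W K) :
    (∑ w, ((a.2 : K) * sl2Phi K (sl2Basis K a.1) (sl2Basis K w)) •
        nord K [(.gamma, -a.2, w), (.c, a.2, a.1)]) v =
      ((a.2 : K) * sl2Scale K a.1) •
        mode K .gamma (-a.2) (sl2Swap a.1) (mode K .c a.2 a.1 v) := by
  simp [sl2Phi_apply, nord_gamma_c, ite_smul]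

theorem slt_summand (a : Fin 3 × ℤ) (v : W K) :
    (∑ w, ((sl2Basis K).repr ((sl2Phi K).symm ((sl2Basis K).coord a.1)) w) •
        nord K [(.beta, -a.2, w), (.b, a.2, a.1)]) v =
      (sl2Scale K a.1)⁻¹ •
        mode K .beta (-a.2) (sl2Swap a.1) (mode K .b a.2 a.1 v) := by
  simp [sl2Phi_symm_coord, nord_beta_b, ite_smul]

theorem slr_gamma (m : ℤ) (j : Fin 3) (w : W K) :
    slr K (mode K .gamma m j w) = mode K .gamma m j (slr K w) := by
  refine (nordSum_apply_of_single (mode K .gamma m j) 1 w (fun _ => 0) (j, 0) (fun a => ?_)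
    (fun a _ => rfl)).trans (by simp [slr, rOp])
  simp only [slr_summand]
  simp [gamma_c, gamma_gamma m]

theorem slr_c (m : ℤ) (j : Fin 3) (w : W K) :
    slr K (mode K .c m j w) = -mode K .c m j (slr K w) := by
  refine (nordSum_apply_of_single (mode K .c m j) (-1) w (fun _ => 0) (j, 0) (fun a => ?_)
    (fun a _ => rfl)).trans (by simp [slr, rOp, weil_neg_smul])
  simp only [slr_summand]
  simp [gamma_c, c_c m]

theorem slr_beta (m : ℤ) (j : Fin 3) (w : W K) :
    slr K (mode K .beta m j w) =
      mode K .beta m j (slr K w) + ((m : K) * sl2Scale K j) • mode K .c m (sl2Swap j) w := by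
  refine (nordSum_apply_of_single (mode K .beta m j) 1 w
    (fun a => if sl2Swap a.1 = j ∧ -a.2 + m = 0 then
      ((a.2 : K) * sl2Scale K a.1) • mode K .c a.2 a.1 w else 0)
    (sl2Swap j, m) (fun a => ?_) (fun a ha => if_neg ?_)).trans
    (by simp [slr, rOp, sl2Swap_swap, sl2Scale_swap])
  · simp only [slr_summand, ← beta_c m, gamma_beta]
    split_ifs <;> simp
  · rintro ⟨h, h'⟩
    exact ha (Prod.ext ((sl2Swap_eq_iff _ _).1 h) (by dsimp; omega))

theorem slr_b (m : ℤ) (j : Fin 3) (w : W K) :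
    slr K (mode K .b m j w) =
      -mode K .b m j (slr K w) - ((m : K) * sl2Scale K j) • mode K .gamma m (sl2Swap j) w := by
  refine (nordSum_apply_of_single (mode K .b m j) (-1) w
    (fun a => if a.1 = j ∧ a.2 + m = 0 then
      ((a.2 : K) * sl2Scale K a.1) • mode K .gamma (-a.2) (sl2Swap a.1) w else 0)
    (j, -m) (fun a => ?_) (fun a ha => if_neg ?_)).trans
    (by simp [slr, rOp, weil_neg_smul, sub_eq_add_neg])
  · simp only [slr_summand, c_b]
    split_ifs <;> simp [gamma_b, weil_neg_smul]
  · rintro ⟨h, h'⟩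
    exact ha (Prod.ext h (by dsimp; omega))

/-- For n = 0 both γ_0 and c_0 are creation operators, and only the coefficient n removes this
summand. -/
theorem slr_vac : slr K (vac K (Fin 3)) = 0 := by
  refine nordSum_eq_zero fun a w => ?_
  rcases lt_trichotomy a.2 0 with h | h | h
  · simp [nord_gamma_c, gamma_c, mode_vac (K := K) (s := .gamma) (n := -a.2) w
      (by simp [Kind.creation]; omega)]
  · simp [h]
  · simp [nord_gamma_c, mode_vac (K := K) (s := .c) (n := a.2) a.1
      (by simp [Kind.creation]; omega)]

theorem slt_beta (m : ℤ) (j : Fin 3) (w : W K) :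
    slt K (mode K .beta m j w) = mode K .beta m j (slt K w) := by
  refine (nordSum_apply_of_single (mode K .beta m j) 1 w (fun _ => 0) (j, 0) (fun a => ?_)
    (fun a _ => rfl)).trans (by simp [slt, tOp])
  simp only [slt_summand]
  simp [beta_b, beta_beta m]

theorem slt_b (m : ℤ) (j : Fin 3) (w : W K) :
    slt K (mode K .b m j w) = -mode K .b m j (slt K w) := by
  refine (nordSum_apply_of_single (mode K .b m j) (-1) w (fun _ => 0) (j, 0) (fun a => ?_)
    (fun a _ => rfl)).trans (by simp [slt, tOp, weil_neg_smul])
  simp only [slt_summand]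
  simp [beta_b, b_b m]

theorem slt_gamma (m : ℤ) (j : Fin 3) (w : W K) :
    slt K (mode K .gamma m j w) =
      mode K .gamma m j (slt K w) - (sl2Scale K j)⁻¹ • mode K .b m (sl2Swap j) w := by
  refine (nordSum_apply_of_single (mode K .gamma m j) 1 w
    (fun a => if j = sl2Swap a.1 ∧ m + -a.2 = 0 then
      -((sl2Scale K a.1)⁻¹ • mode K .b a.2 a.1 w) else 0)
    (sl2Swap j, m) (fun a => ?_) (fun a ha => if_neg ?_)).trans
    (by simp [slt, tOp, sl2Swap_swap, sl2Scale_swap, sub_eq_add_neg])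
  · simp only [slt_summand, ← gamma_b m, beta_gamma]
    split_ifs <;> simp [sub_eq_add_neg]
  · rintro ⟨h, h'⟩
    exact ha (Prod.ext ((sl2Swap_eq_iff _ _).1 h.symm) (by dsimp; omega))

theorem slt_c (m : ℤ) (j : Fin 3) (w : W K) :
    slt K (mode K .c m j w) =
      -mode K .c m j (slt K w) + (sl2Scale K j)⁻¹ • mode K .beta m (sl2Swap j) w := by
  refine (nordSum_apply_of_single (mode K .c m j) (-1) w
    (fun a => if j = a.1 ∧ m + a.2 = 0 then
      ((sl2Scale K a.1)⁻¹ • mode K .beta (-a.2) (sl2Swap a.1) w) else 0)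
    (j, -m) (fun a => ?_) (fun a ha => if_neg ?_)).trans
    (by simp [slt, tOp, weil_neg_smul])
  · simp only [slt_summand, b_c]
    split_ifs <;> simp [beta_c, weil_neg_smul]
  · rintro ⟨h, h'⟩
    exact ha (Prod.ext h.symm (by dsimp; omega))

theorem slt_vac : slt K (vac K (Fin 3)) = 0 := by
  refine nordSum_eq_zero fun a w => ?_
  by_cases h : a.2 ≤ -1
  · simp [nord_beta_b, beta_b, mode_vac (K := K) (s := .beta) (n := -a.2) w
      (by simp [Kind.creation]; omega)]
  · simp [nord_beta_b, mode_vac (K := K) (s := .b) (n := a.2) a.1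
      (by simp [Kind.creation]; omega)]

end Sl2Operators

/-! ### Relations between h, k and L_0. -/

section Relations

variable {K : Type*} [Field K] {ι : Type*} [Fintype ι]

theorem koszul_koszul (w : Weil K ι) : koszul K ι (koszul K ι w) = 0 := by
  induction w using weil_induction with
  | hv => simp [koszul_vac]
  | hadd v w hv hw => simp [hv, hw]
  | hsmul a w hw => simp [hw]
  | hmode s n i w hw =>
    cases s <;> simp [koszul_b, koszul_c, koszul_beta, koszul_gamma, hw]

theorem homotopy_homotopy (w : Weil K ι) : homotopy K ι (homotopy K ι w) = 0 := by
  induction w using weil_induction with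
  | hv => simp [homotopy_vac]
  | hadd v w hv hw => simp [hv, hw]
  | hsmul a w hw => simp [hw]
  | hmode s n i w hw =>
    cases s <;> simp [homotopy_b, homotopy_c, homotopy_beta, homotopy_gamma, hw]

/-- The anticommutator of two odd superderivations is an even derivation. On each pair β, b and γ, c
of index m, the composite of h and k is multiplication by m, which is the commutator with -L_0, and
both sides kill the vacuum. -/
theorem koszul_homotopy (w : Weil K ι) :
    koszul K ι (homotopy K ι w) = -L0 K ι w - homotopy K ι (koszul K ι w) := by
  rw [eq_sub_iff_add_eq]
  induction w using weil_induction with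
  | hv => simp [homotopy_vac, koszul_vac, L0_vac]
  | hadd v w hv hw =>
    simp only [map_add, neg_add, ← hv, ← hw]
    abel
  | hsmul a w hw => simp only [map_smul, ← smul_add, hw, smul_neg]
  | hmode s n i w hw =>
    have h : L0 K ι w = -(koszul K ι (homotopy K ι w) + homotopy K ι (koszul K ι w)) := by
      rw [hw, neg_neg]
    cases s <;> simp only [homotopy_b, homotopy_c, homotopy_beta, homotopy_gamma, koszul_b,
      koszul_c, koszul_beta, koszul_gamma, map_add, map_neg, map_smul, L0_mode, h] <;> module

theorem L0_koszul (w : Weil K ι) : L0 K ι (koszul K ι w) = koszul K ι (L0 K ι w) := by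
  induction w using weil_induction with
  | hv => simp [koszul_vac, L0_vac]
  | hadd v w hv hw => simp only [map_add, hv, hw]
  | hsmul a w hw => simp only [map_smul, hw]
  | hmode s n i w hw =>
    cases s <;> simp only [koszul_b, koszul_c, koszul_beta, koszul_gamma, map_add, map_neg,
      map_sub, map_smul, L0_mode, hw] <;> module

theorem L0_homotopy (w : Weil K ι) : L0 K ι (homotopy K ι w) = homotopy K ι (L0 K ι w) := by
  induction w using weil_induction with
  | hv => simp [homotopy_vac, L0_vac]
  | hadd v w hv hw => simp only [map_add, hv, hw]
  | hsmul a w hw => simp only [map_smul, hw]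
  | hmode s n i w hw =>
    cases s <;> simp only [homotopy_b, homotopy_c, homotopy_beta, homotopy_gamma, map_add, map_neg,
      map_sub, map_smul, L0_mode, hw] <;> module

end Relations

/-! ### Relations of r and t with each other and with h, k, L_0. -/

section Sl2Relations

variable {K : Type*} [Field K] [CharZero K]

theorem slr_slr (w : W K) : slr K (slr K w) = 0 := by
  induction w using weil_induction with
  | hv => simp [slr_vac]
  | hadd v w hv hw => simp [hv, hw]
  | hsmul a w hw => simp [hw]
  | hmode s n i w hw => cases s <;> simp [slr_b, slr_c, slr_beta, slr_gamma, hw]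

theorem slt_slt (w : W K) : slt K (slt K w) = 0 := by
  induction w using weil_induction with
  | hv => simp [slt_vac]
  | hadd v w hv hw => simp [hv, hw]
  | hsmul a w hw => simp [hw]
  | hmode s n i w hw => cases s <;> simp [slt_b, slt_c, slt_beta, slt_gamma, hw]

/-- The same derivation argument as for h and k; the scale factors of φ and of its inverse cancel.
-/
theorem slr_slt (w : W K) : slr K (slt K w) = -L0 K (Fin 3) w - slt K (slr K w) := by
  rw [eq_sub_iff_add_eq]
  induction w using weil_induction with
  | hv => simp [slr_vac, slt_vac, L0_vac]
  | hadd v w hv hw =>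
    simp only [map_add, neg_add, ← hv, ← hw]
    abel
  | hsmul a w hw => simp only [map_smul, ← smul_add, hw, smul_neg]
  | hmode s n i w hw =>
    have h : L0 K (Fin 3) w = -(slr K (slt K w) + slt K (slr K w)) := by
      rw [hw, neg_neg]
    have h0 := sl2Scale_ne_zero (K := K) i
    cases s <;> simp only [slr_b, slr_c, slr_beta, slr_gamma, slt_b, slt_c, slt_beta, slt_gamma,
      map_add, map_neg, map_sub, map_smul, L0_mode, h, sl2Swap_swap, sl2Scale_swap] <;>
      match_scalars <;> field_simp <;> ring

theorem L0_slr (w : W K) : L0 K (Fin 3) (slr K w) = slr K (L0 K (Fin 3) w) := by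
  induction w using weil_induction with
  | hv => simp [slr_vac, L0_vac]
  | hadd v w hv hw => simp only [map_add, hv, hw]
  | hsmul a w hw => simp only [map_smul, hw]
  | hmode s n i w hw =>
    cases s <;> simp only [slr_b, slr_c, slr_beta, slr_gamma, map_add, map_neg,
      map_sub, map_smul, L0_mode, hw] <;> module

theorem L0_slt (w : W K) : L0 K (Fin 3) (slt K w) = slt K (L0 K (Fin 3) w) := by
  induction w using weil_induction with
  | hv => simp [slt_vac, L0_vac]
  | hadd v w hv hw => simp only [map_add, hv, hw]
  | hsmul a w hw => simp only [map_smul, hw]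
  | hmode s n i w hw =>
    cases s <;> simp only [slt_b, slt_c, slt_beta, slt_gamma, map_add, map_neg,
      map_sub, map_smul, L0_mode, hw] <;> module

/-- The only generator on which a product of the two is nonzero is β: through c and through b one
reaches the same multiple of γ with opposite signs. The next three relations follow the same
pattern. -/
theorem slh_slr (w : W K) : slh K (slr K w) = -slr K (slh K w) := by
  induction w using weil_induction with
  | hv => simp [slr_vac, koszul_vac]
  | hadd v w hv hw => simp only [map_add, hv, hw, neg_add]
  | hsmul a w hw => simp only [map_smul, hw, smul_neg]
  | hmode s n i w hw =>
    cases s <;> simp only [slr_b, slr_c, slr_beta, slr_gamma, koszul_b, koszul_c, koszul_beta,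
      koszul_gamma, map_add, map_neg, map_sub, map_smul, hw] <;> module

theorem slh_slt (w : W K) : slh K (slt K w) = -slt K (slh K w) := by
  induction w using weil_induction with
  | hv => simp [slt_vac, koszul_vac]
  | hadd v w hv hw => simp only [map_add, hv, hw, neg_add]
  | hsmul a w hw => simp only [map_smul, hw, smul_neg]
  | hmode s n i w hw =>
    cases s <;> simp only [slt_b, slt_c, slt_beta, slt_gamma, koszul_b, koszul_c, koszul_beta,
      koszul_gamma, map_add, map_neg, map_sub, map_smul, hw] <;> module

theorem slk_slr (w : W K) : slk K (slr K w) = -slr K (slk K w) := by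
  induction w using weil_induction with
  | hv => simp [slr_vac, homotopy_vac]
  | hadd v w hv hw => simp only [map_add, hv, hw, neg_add]
  | hsmul a w hw => simp only [map_smul, hw, smul_neg]
  | hmode s n i w hw =>
    cases s <;> simp only [slr_b, slr_c, slr_beta, slr_gamma, homotopy_b, homotopy_c,
      homotopy_beta, homotopy_gamma, map_add, map_neg, map_sub, map_smul, hw] <;> module

theorem slk_slt (w : W K) : slk K (slt K w) = -slt K (slk K w) := by
  induction w using weil_induction with
  | hv => simp [slt_vac, homotopy_vac]
  | hadd v w hv hw => simp only [map_add, hv, hw, neg_add]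
  | hsmul a w hw => simp only [map_smul, hw, smul_neg]
  | hmode s n i w hw =>
    cases s <;> simp only [slt_b, slt_c, slt_beta, slt_gamma, homotopy_b, homotopy_c,
      homotopy_beta, homotopy_gamma, map_add, map_neg, map_sub, map_smul, hw] <;> module

end Sl2Relations

/-! ### Q as a locally finite sum of cubic terms without normal ordering. -/

section Differential

variable {K : Type*} [Field K]

/-- Contraction of a family with the structure constants of `sl(2)`. -/
def sl2Contract (F : Fin 3 → Fin 3 → Fin 3 → W K) : W K :=
  F 0 1 2 - F 1 0 2 + (2 : K) • F 2 0 0 - (2 : K) • F 0 2 0 - (2 : K) • F 2 1 1 + (2 : K) • F 1 2 1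

theorem sl2Basis_repr (A : Sl2 K) (w : Fin 3) :
    (sl2Basis K).repr A w = ![A.1 0 1, A.1 1 0, A.1 0 0] w := rfl

theorem sl2Basis_val (u : Fin 3) :
    (sl2Basis K u).1 = ![!![0, 1; 0, 0], !![0, 0; 1, 0], !![1, 0; 0, -1]] u := by
  rw [sl2Basis, Module.Basis.coe_ofEquivFun]
  change !![(Pi.single u 1 : Fin 3 → K) 2, (Pi.single u 1 : Fin 3 → K) 0;
    (Pi.single u 1 : Fin 3 → K) 1, -(Pi.single u 1 : Fin 3 → K) 2] = _
  fin_cases u <;> simp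

theorem sum_structureConstants (F : Fin 3 → Fin 3 → Fin 3 → W K) :
    ∑ a : Fin 3 × Fin 3, ∑ w, (sl2Basis K).repr ⁅sl2Basis K a.1, sl2Basis K a.2⁆ w • F a.1 a.2 w =
      sl2Contract F := by
  have h (u v : Fin 3) : (⁅sl2Basis K u, sl2Basis K v⁆ : Sl2 K).1 =
      (sl2Basis K u).1 * (sl2Basis K v).1 - (sl2Basis K v).1 * (sl2Basis K u).1 := rfl
  simp only [Fintype.sum_prod_type, Fin.sum_univ_three, sl2Basis_repr, h, sl2Basis_val,
    sl2Contract]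
  simp only [Matrix.cons_val, Matrix.sub_apply, Matrix.mul_apply, Fin.sum_univ_two,
    Matrix.of_apply]
  module

/-- The `(i, j)` summand of `Q`. -/
def qTerm (i j : ℤ) (x : W K) : W K :=
  sl2Contract (fun u v w =>
      mode K .gamma (-i) v (mode K .c (-j) u (mode K .beta (i + j) w x))) +
    (1 / 2 : K) • sl2Contract (fun u v w =>
      mode K .b (i + j) w (mode K .c (-i) v (mode K .c (-j) u x)))

/-- Reordering contracts γ^{v'} with β^{[u,v]}; summed over v this is the trace of ad u, which is
zero. -/
theorem sl2Contract_nord_beta_gamma_c (n p q : ℤ) (x : W K) :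
    sl2Contract (fun u v w => nord K [(.beta, n, w), (.gamma, p, v), (.c, q, u)] x) =
      sl2Contract (fun u v w =>
        mode K .gamma p v (mode K .c q u (mode K .beta n w x))) := by
  by_cases h1 : n ≤ -1 <;> by_cases h2 : p ≤ 0 <;> by_cases h3 : q ≤ 0 <;>
  simp [sl2Contract, nord, Kind.creation, Kind.odd, h1, h2, h3, gamma_beta, gamma_c, beta_c] <;>
  module

/-- Contractions of b^{[u,v]} with either c again sum to traces of ad, and the two c's anticommute.
-/
theorem sl2Contract_nord_b_c_c (n p q : ℤ) (x : W K) :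
    sl2Contract (fun u v w => nord K [(.b, n, w), (.c, p, v), (.c, q, u)] x) =
      sl2Contract (fun u v w =>
        mode K .b n w (mode K .c p v (mode K .c q u x))) := by
  by_cases h1 : n ≤ -1 <;> by_cases h2 : p ≤ 0 <;> by_cases h3 : q ≤ 0 <;>
  simp [sl2Contract, nord, Kind.creation, Kind.odd, h1, h2, h3, c_b, c_c q p] <;>
  module

/-- Separates the finite sum over Lie algebra indices from the sum over mode indices, so that the
contraction with structure constants, and with it the cancellation of traces, happens for each fixed
(i, j). -/
theorem nordSum_triple (l : (Fin 3 × Fin 3) × ℤ × ℤ → Fin 3 → List (Kind × ℤ × Fin 3))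
    (hl : ∀ N : ℤ, {a | ∃ j, ∀ x ∈ l a j, x.2.1 ≤ N}.Finite) (x : W K) :
    nordSum (fun (a : (Fin 3 × Fin 3) × ℤ × ℤ) w =>
        (sl2Basis K).repr ⁅sl2Basis K a.1.1, sl2Basis K a.1.2⁆ w) l hl x =
      ∑ᶠ p : ℤ × ℤ, sl2Contract (fun u v w => nord K (l ((u, v), p) w) x) := by
  have hfin := nord_locFinite (K := K) (fun (a : (Fin 3 × Fin 3) × ℤ × ℤ) w =>
        (sl2Basis K).repr ⁅sl2Basis K a.1.1, sl2Basis K a.1.2⁆ w) l hl x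
  refine (finsum_curry _ hfin).trans ?_
  rw [finsum_eq_sum_of_fintype, ← finsum_sum_comm]
  · refine finsum_congr fun p => ?_
    rw [← sum_structureConstants]
    simp only [LinearMap.sum_apply, LinearMap.smul_apply]
  · intro a _
    exact hfin.preimage (f := fun p => (a, p)) fun p _ q _ h => (Prod.ext_iff.1 h).2

/-- A family indexed by pairs `(i, j)` has finite support when its members with one of
`i + j`, `-i`, `-j` large vanish. -/
theorem finite_support_of_large {F : ℤ × ℤ → W K} (N : ℤ)
    (h1 : ∀ i j, N < i + j → F (i, j) = 0) (h2 : ∀ i j, N < -i → F (i, j) = 0)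
    (h3 : ∀ i j, N < -j → F (i, j) = 0) : (Function.support F).Finite := by
  refine ((Set.finite_Icc (-N) (2 * N)).prod (Set.finite_Icc (-N) (2 * N))).subset ?_
  rintro ⟨i, j⟩ hp
  have k1 : i + j ≤ N := not_lt.1 fun h => hp (h1 i j h)
  have k2 : -i ≤ N := not_lt.1 fun h => hp (h2 i j h)
  have k3 : -j ≤ N := not_lt.1 fun h => hp (h3 i j h)
  simp only [Set.mem_prod, Set.mem_Icc]
  omega

/-- Each of the three modes can be moved to the right end, where it kills `x` if its index is large;
the contractions met on the way are traces of ad. -/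
theorem finite_support_sl2Contract_beta (x : W K) :
    (Function.support fun p : ℤ × ℤ => sl2Contract (fun u v w =>
      mode K .gamma (-p.1) v (mode K .c (-p.2) u (mode K .beta (p.1 + p.2) w x)))).Finite := by
  obtain ⟨N, hN⟩ := exists_bounded x
  refine finite_support_of_large N (fun i j h => ?_) (fun i j h => ?_) (fun i j h => ?_)
  · simp [sl2Contract, fun w => mode_large (s := .beta) hN w (by omega : (N : ℤ) + 1 ≤ i + j)]
  · simp [sl2Contract, gamma_c, gamma_beta,
      fun w => mode_large (s := .gamma) hN w (by omega : (N : ℤ) + 1 ≤ -i)]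
  · simp [sl2Contract, ← beta_c,
      fun w => mode_large (s := .c) hN w (by omega : (N : ℤ) + 1 ≤ -j)]

theorem finite_support_sl2Contract_b (x : W K) :
    (Function.support fun p : ℤ × ℤ => sl2Contract (fun u v w =>
      mode K .b (p.1 + p.2) w (mode K .c (-p.1) v (mode K .c (-p.2) u x)))).Finite := by
  obtain ⟨N, hN⟩ := exists_bounded x
  refine finite_support_of_large N (fun i j h => ?_) (fun i j h => ?_) (fun i j h => ?_)
  · simp [sl2Contract, b_c,
      fun w => mode_large (s := .b) hN w (by omega : (N : ℤ) + 1 ≤ i + j)]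
  · simp [sl2Contract, c_c (-i) (-j),
      fun w => mode_large (s := .c) hN w (by omega : (N : ℤ) + 1 ≤ -i)]
  · simp [sl2Contract,
      fun w => mode_large (s := .c) hN w (by omega : (N : ℤ) + 1 ≤ -j)]

theorem finite_support_qTerm (x : W K) :
    (Function.support fun p : ℤ × ℤ => qTerm p.1 p.2 x).Finite := by
  refine ((finite_support_sl2Contract_beta x).union (finite_support_sl2Contract_b x)).subset ?_
  intro p hp
  by_contra hcon
  simp only [Set.mem_union, Function.mem_support, not_or, not_not] at hcon
  exact hp (by simp [qTerm, hcon])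

/-- Since `sl(2)` is unimodular, normal ordering is not needed in the definition of `Q`. -/
theorem slQ_apply (x : W K) : slQ K x = ∑ᶠ p : ℤ × ℤ, qTerm p.1 p.2 x := by
  simp only [qTerm]
  rw [finsum_add_distrib (finite_support_sl2Contract_beta x)
    ((finite_support_sl2Contract_b x).subset fun p hp h0 => hp (by simp at h0; simp [h0])),
    ← smul_finsum' _ (finite_support_sl2Contract_b x)]
  refine (LinearMap.add_apply _ _ x).trans (congrArg₂ (· + ·) ?_ ?_)
  · rw [nordSum_triple]
    exact finsum_congr fun p => sl2Contract_nord_beta_gamma_c _ _ _ x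
  · rw [LinearMap.smul_apply, nordSum_triple]
    exact congrArg _ (finsum_congr fun p => sl2Contract_nord_b_c_c _ _ _ x)

end Differential

/-! ### Q commutes with L_0 and anticommutes with h, k, r, t. -/

section Anticommutation

variable {K : Type*} [Field K]

theorem map_sl2Contract (D : Module.End K (W K)) (F : Fin 3 → Fin 3 → Fin 3 → W K) :
    D (sl2Contract F) = sl2Contract (fun u v w => D (F u v w)) := by
  simp [sl2Contract]

/-- The anticommutator of `Q` with an operator is the sum of the anticommutators of its
summands. -/
theorem slQ_anticommute {D : Module.End K (W K)} {E : ℤ → ℤ → W K} {x : W K}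
    (h : ∀ i j, D (qTerm i j x) + qTerm i j (D x) = E i j)
    (hE : ∑ᶠ p : ℤ × ℤ, E p.1 p.2 = 0) : slQ K (D x) = -D (slQ K x) := by
  rw [eq_neg_iff_add_eq_zero, add_comm, slQ_apply, slQ_apply,
    map_finsum D (finite_support_qTerm x), ← finsum_add_distrib]
  · simpa only [h] using hE
  · exact (finite_support_qTerm x).subset fun p hp h0 => hp (by simp at h0; simp [h0])
  · exact finite_support_qTerm (D x)

/-- The involution of the index set which exchanges `i + j` and `-i`. -/
def exchFst : ℤ × ℤ ≃ ℤ × ℤ where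
  toFun p := (-p.1 - p.2, p.2)
  invFun p := (-p.1 - p.2, p.2)
  left_inv p := by ext <;> simp
  right_inv p := by ext <;> simp

/-- The involution of the index set which exchanges `i + j` and `-j`. -/
def exchSnd : ℤ × ℤ ≃ ℤ × ℤ where
  toFun p := (p.1, -p.1 - p.2)
  invFun p := (p.1, -p.1 - p.2)
  left_inv p := by ext <;> simp
  right_inv p := by ext <;> simp

/-- Reindexing by a bijection preserves the sum, and 1 + 1 - 2 = 0. The anticommutators of Q with t
and r leave remainders of this shape. -/
theorem finsum_symmetrization_eq_zero {I : Type*} (e e' : I ≃ I) (F : I → W K)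
    (hF : (Function.support F).Finite) :
    ∑ᶠ p, (F p + F (e p) - (2 : K) • F (e' p)) = 0 := by
  have h1 : (Function.support fun p => F (e p)).Finite := hF.preimage e.injective.injOn
  have h2 : (Function.support fun p => F (e' p)).Finite := hF.preimage e'.injective.injOn
  have h3 : (Function.support fun p => (2 : K) • F (e' p)).Finite :=
    h2.subset fun p hp h0 => hp (by simp [show F (e' p) = 0 from h0])
  have h4 : (Function.support fun p => F p + F (e p)).Finite :=
    (hF.union h1).subset (Function.support_add _ _)
  rw [finsum_sub_distrib h4 h3, finsum_add_distrib hF h1, ← smul_finsum' _ h2,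
    finsum_comp_equiv e, finsum_comp_equiv e', two_smul, sub_self]

/-- The mode indices in each cubic term add up to (i + j) - i - j = 0, so every term preserves the
weight. -/
theorem L0_slQ (x : W K) : L0 K (Fin 3) (slQ K x) = slQ K (L0 K (Fin 3) x) := by
  rw [slQ_apply, slQ_apply, map_finsum _ (finite_support_qTerm x)]
  refine finsum_congr fun p => ?_
  simp only [qTerm, map_add, map_smul, map_sl2Contract, L0_mode, map_sub]
  simp only [sl2Contract]
  push_cast
  module

variable [CharZero K]

/-- The sum equals its own negative, and 2 is invertible. -/
theorem finsum_eq_zero_of_antisymm {I : Type*} (e : I ≃ I) (F : I → W K)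
    (h : ∀ p, F (e p) = -F p) : ∑ᶠ p, F p = 0 := by
  have h1 : ∑ᶠ p, F (e p) = ∑ᶠ p, F p := finsum_comp_equiv e
  simp only [h, finsum_neg_distrib] at h1
  have h2 : (2 : K) • ∑ᶠ p, F p = 0 := by
    rw [two_smul]; nth_rewrite 1 [← h1]; simp
  exact (smul_eq_zero.1 h2).resolve_left two_ne_zero

/-- The remainder is the anticommutator of the (i, j) term itself. It is odd under exchange of i and
j, since exchanging u and v changes the sign of the bracket. -/
theorem slQ_slh (x : W K) : slQ K (slh K x) = -slh K (slQ K x) := by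
  refine slQ_anticommute (fun i j => rfl) (finsum_eq_zero_of_antisymm (Equiv.prodComm ℤ ℤ) _ ?_)
  rintro ⟨i, j⟩
  simp only [Equiv.prodComm_apply, Prod.swap_prod_mk, qTerm, map_add, map_smul, map_sl2Contract,
    koszul_gamma, koszul_beta, koszul_b, koszul_c, map_neg]
  simp [sl2Contract, gamma_b, gamma_c, c_b, gamma_gamma (-j) (-i), add_comm j i]
  module

/-- Both halves of Q contribute c c β terms, with total coefficient -i + (i + j)/2 = (j - i)/2. This
is odd in (i, j), while the contracted product is symmetric because bracket and c's both change
sign. -/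
theorem slQ_slk (x : W K) : slQ K (slk K x) = -slk K (slQ K x) := by
  refine slQ_anticommute (fun i j => rfl) (finsum_eq_zero_of_antisymm (Equiv.prodComm ℤ ℤ) _ ?_)
  rintro ⟨i, j⟩
  simp only [Equiv.prodComm_apply, Prod.swap_prod_mk, qTerm, map_add, map_smul, map_sl2Contract,
    homotopy_gamma, homotopy_beta, homotopy_b, homotopy_c, map_neg]
  simp [sl2Contract, beta_c, c_c (-j) (-i), add_comm j i]
  module

/-- `A` comes from t acting on c in the βγc half. The two values of `F` come from t acting on either
c in the bcc half, and the third from t acting on γ. Invariance of φ identifies the last with `F`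
after the indices i + j and -i are exchanged. -/
theorem slQ_slt (x : W K) : slQ K (slt K x) = -slt K (slQ K x) := by
  let A (p : ℤ × ℤ) : W K := sl2Contract (fun u v w => (sl2Scale K u)⁻¹ •
    mode K .gamma (-p.1) v (mode K .beta (-p.2) (sl2Swap u) (mode K .beta (p.1 + p.2) w x)))
  let F (p : ℤ × ℤ) : W K := (-1 / 2 : K) • sl2Contract (fun u v w => (sl2Scale K v)⁻¹ •
    mode K .b (p.1 + p.2) w (mode K .beta (-p.1) (sl2Swap v) (mode K .c (-p.2) u x)))
  obtain ⟨N, hN⟩ := exists_bounded x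
  have hA : (Function.support A).Finite := by
    refine finite_support_of_large N (fun i j h => ?_) (fun i j h => ?_) (fun i j h => ?_)
    · simp [A, sl2Contract, fun w => mode_large (s := .beta) hN w (by omega : (N : ℤ) + 1 ≤ i + j)]
    · simp [A, sl2Contract, sl2Swap, sl2Scale, gamma_beta,
        fun w => mode_large (s := .gamma) hN w (by omega : (N : ℤ) + 1 ≤ -i)]
    · simp [A, sl2Contract, beta_beta (-j),
        fun w => mode_large (s := .beta) hN w (by omega : (N : ℤ) + 1 ≤ -j)]
  have hF : (Function.support F).Finite := by
    refine finite_support_of_large N (fun i j h => ?_) (fun i j h => ?_) (fun i j h => ?_)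
    · simp [F, sl2Contract, sl2Swap, sl2Scale, b_c, ← beta_b,
        fun w => mode_large (s := .b) hN w (by omega : (N : ℤ) + 1 ≤ i + j)]
    · simp [F, sl2Contract, beta_c,
        fun w => mode_large (s := .beta) hN w (by omega : (N : ℤ) + 1 ≤ -i)]
    · simp [F, sl2Contract,
        fun w => mode_large (s := .c) hN w (by omega : (N : ℤ) + 1 ≤ -j)]
  refine slQ_anticommute (E := fun i j => A (i, j) +
    (F (i, j) + F (Equiv.prodComm ℤ ℤ (i, j)) - (2 : K) • F (exchFst (i, j))))
    (fun i j => ?_) ?_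
  · simp only [qTerm, map_add, map_smul, map_sl2Contract, slt_gamma, slt_beta, slt_b, slt_c,
      map_neg]
    simp [A, F, exchFst, sl2Contract, sl2Swap, sl2Scale, beta_c, gamma_c, add_comm j i]
    module
  · rw [finsum_add_distrib hA, finsum_symmetrization_eq_zero _ _ _ hF, add_zero]
    -- By invariance, the sum over u of φ⁻¹(u') ⊗ [u, v] is antisymmetric, while the two β's
    -- commute.
    · refine finsum_eq_zero_of_antisymm exchSnd A ?_
      rintro ⟨i, j⟩
      simp [A, exchSnd, sl2Contract, sl2Swap, sl2Scale, beta_beta (i + j) (-j),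
        (by ring : i + (-i - j) = -j), add_comm j i]
      module
    · have h1 : (Function.support fun p => F (Equiv.prodComm ℤ ℤ p)).Finite :=
        hF.preimage (Equiv.injective _).injOn
      have h2 : (Function.support fun p => F (exchFst p)).Finite :=
        hF.preimage (Equiv.injective _).injOn
      refine ((hF.union h1).union h2).subset fun p hp => ?_
      by_contra hcon
      simp only [Set.mem_union, Function.mem_support, not_or, not_not] at hcon
      exact hp (by simp only [hcon]; simp)

/-- r acting on b gives the coefficient -(i + j)/2, split between `F` and its value at (j, i). r
acting on β gives the third term, with the indices i + j and -i exchanged by invariance. -/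
theorem slQ_slr (x : W K) : slQ K (slr K x) = -slr K (slQ K x) := by
  let F (p : ℤ × ℤ) : W K := (-1 / 2 * p.1 : K) • sl2Contract (fun u v w => sl2Scale K w •
    mode K .gamma (p.1 + p.2) (sl2Swap w) (mode K .c (-p.1) v (mode K .c (-p.2) u x)))
  obtain ⟨N, hN⟩ := exists_bounded x
  have hF : (Function.support F).Finite := by
    refine finite_support_of_large N (fun i j h => ?_) (fun i j h => ?_) (fun i j h => ?_)
    · simp [F, sl2Contract, gamma_c,
        fun w => mode_large (s := .gamma) hN w (by omega : (N : ℤ) + 1 ≤ i + j)]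
    · simp [F, sl2Contract, c_c (-i) (-j),
        fun w => mode_large (s := .c) hN w (by omega : (N : ℤ) + 1 ≤ -i)]
    · simp [F, sl2Contract,
        fun w => mode_large (s := .c) hN w (by omega : (N : ℤ) + 1 ≤ -j)]
  refine slQ_anticommute (E := fun i j =>
    F (i, j) + F (Equiv.prodComm ℤ ℤ (i, j)) - (2 : K) • F (exchFst (i, j)))
    (fun i j => ?_) (finsum_symmetrization_eq_zero (Equiv.prodComm ℤ ℤ) exchFst F hF)
  simp only [qTerm, map_add, map_smul, map_sl2Contract, slr_gamma, slr_beta, slr_b, slr_c,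
    map_neg]
  simp [F, exchFst, sl2Contract, sl2Swap, sl2Scale, gamma_c, c_c (-j) (-i), c_c (-j) (i + j),
    add_comm j i]
  module

end Anticommutation

/-! ### The four summands of weight one and the isomorphisms between them. -/

section Decomposition

variable {K : Type*} [Field K]

theorem mem_W1_iff {w : W K} : w ∈ W1 K ↔ L0 K (Fin 3) w = w := by
  rw [W1, Module.End.mem_eigenspace_iff, one_smul]

theorem slk_slh {w : W K} (hw : L0 K (Fin 3) w = w) :
    slk K (slh K w) = -w - slh K (slk K w) := by
  rw [koszul_homotopy, hw]; abel

variable [CharZero K]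

theorem mem_summand_zero {w : W K} :
    w ∈ summand K 0 ↔ L0 K (Fin 3) w = w ∧ slh K w = 0 ∧ slr K w = 0 := by
  simp [summand, Submodule.mem_inf]

theorem mem_summand_one {w : W K} :
    w ∈ summand K 1 ↔ L0 K (Fin 3) w = w ∧ slh K w = 0 ∧ slt K w = 0 := by
  simp [summand, Submodule.mem_inf]

theorem mem_summand_two {w : W K} :
    w ∈ summand K 2 ↔ L0 K (Fin 3) w = w ∧ slk K w = 0 ∧ slr K w = 0 := by
  simp [summand, Submodule.mem_inf]

theorem mem_summand_three {w : W K} :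
    w ∈ summand K 3 ↔ L0 K (Fin 3) w = w ∧ slk K w = 0 ∧ slt K w = 0 := by
  simp [summand, Submodule.mem_inf]

variable (K) in
/-- The projections of the subspace of weight one to its four summands. -/
def summandProj : Fin 4 → Module.End K (W K) :=
  ![slh K * slk K * (slr K * slt K), slh K * slk K * (slt K * slr K),
    slk K * slh K * (slr K * slt K), slk K * slh K * (slt K * slr K)]

theorem slt_slr {w : W K} (hw : L0 K (Fin 3) w = w) :
    slt K (slr K w) = -w - slr K (slt K w) := by
  rw [slr_slt, hw]; abel

theorem summandProj_mem (p : Fin 4) {w : W K} (hw : L0 K (Fin 3) w = w) :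
    summandProj K p w ∈ summand K p := by
  fin_cases p
  · refine mem_summand_zero.2 ?_
    simp [summandProj, koszul_homotopy, slr_slt, slh_slr, slh_slt, slk_slr, slk_slt,
      koszul_koszul, slr_slr, L0_slr, L0_slt, L0_koszul, L0_homotopy, hw]
    abel
  · refine mem_summand_one.2 ?_
    simp [summandProj, koszul_homotopy, slh_slr, slh_slt, slk_slr, slk_slt, koszul_koszul,
      slt_slt, L0_slr, L0_slt, L0_koszul, L0_homotopy, hw]
  · refine mem_summand_two.2 ?_
    simp [summandProj, slr_slt, slh_slr, slh_slt, slk_slr, slk_slt, homotopy_homotopy, slr_slr,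
      L0_slr, L0_slt, L0_koszul, L0_homotopy, hw]
  · refine mem_summand_three.2 ?_
    simp [summandProj, slh_slr, slh_slt, slk_slr, slk_slt, homotopy_homotopy, slt_slt, L0_slr,
      L0_slt, L0_koszul, L0_homotopy, hw]

/-- Expansion of (-hk - kh)(-rt - tr), a product of two identity operators in weight one; the signs
cancel in each of the four products. -/
theorem sum_summandProj {w : W K} (hw : L0 K (Fin 3) w = w) :
    summandProj K 0 w + summandProj K 1 w + summandProj K 2 w + summandProj K 3 w = w := by
  simp [summandProj, koszul_homotopy, slr_slt, slh_slr, slh_slt, slk_slr, slk_slt, hw]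
  abel

theorem summandProj_self (p : Fin 4) {w : W K} (hw : w ∈ summand K p) :
    summandProj K p w = w := by
  fin_cases p
  · obtain ⟨h0, h1, h2⟩ := mem_summand_zero.1 hw
    simp [summandProj, koszul_homotopy, slr_slt, h0, h1, h2]
  · obtain ⟨h0, h1, h2⟩ := mem_summand_one.1 hw
    simp [summandProj, koszul_homotopy, slt_slr, h0, h1, h2]
  · obtain ⟨h0, h1, h2⟩ := mem_summand_two.1 hw
    simp [summandProj, slk_slh, slr_slt, h0, h1, h2]
  · obtain ⟨h0, h1, h2⟩ := mem_summand_three.1 hw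
    simp [summandProj, slk_slh, slt_slr, h0, h1, h2]

/-- Some operator which kills `w` occurs in the product and can be brought next to `w` by
anticommutation. -/
theorem summandProj_of_ne {p q : Fin 4} (hpq : p ≠ q) {w : W K} (hw : w ∈ summand K q) :
    summandProj K p w = 0 := by
  have h0 : q = 0 → slh K w = 0 ∧ slr K w = 0 := by
    rintro rfl; exact (mem_summand_zero.1 hw).2
  have h1 : q = 1 → slh K w = 0 ∧ slt K w = 0 := by
    rintro rfl; exact (mem_summand_one.1 hw).2
  have h2 : q = 2 → slk K w = 0 ∧ slr K w = 0 := by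
    rintro rfl; exact (mem_summand_two.1 hw).2
  have h3 : q = 3 → slk K w = 0 ∧ slt K w = 0 := by
    rintro rfl; exact (mem_summand_three.1 hw).2
  fin_cases p <;> fin_cases q <;>
    simp only [Fin.zero_eta, Fin.mk_one, Fin.reduceFinMk, ne_eq, not_true_eq_false, true_imp_iff]
      at hpq h0 h1 h2 h3 <;>
    simp [summandProj, slk_slr, slk_slt, slh_slr, slh_slt, *]

theorem iSupIndep_summand : iSupIndep (summand K) := by
  intro p
  rw [Submodule.disjoint_def]
  intro w hw hw'
  have h : ⨆ q, ⨆ (_ : q ≠ p), summand K q ≤ LinearMap.ker (summandProj K p) :=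
    iSup₂_le fun q hq v hv => summandProj_of_ne hq.symm hv
  rw [← summandProj_self p hw]
  exact h hw'

theorem iSup_summand : iSup (summand K) = W1 K := by
  refine le_antisymm (iSup_le fun p => ?_) fun w hw => ?_
  · fin_cases p <;> exact inf_le_left
  · have h := mem_W1_iff.1 hw
    rw [← sum_summandProj h]
    have hm := fun p => Submodule.mem_iSup_of_mem p (summandProj_mem p h)
    exact add_mem (add_mem (add_mem (hm 0) (hm 1)) (hm 2)) (hm 3)

theorem slQ_mem_summand (p : Fin 4) (w : W K) (hw : w ∈ summand K p) :
    slQ K w ∈ summand K p := by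
  have hL : ∀ {w : W K}, L0 K (Fin 3) w = w → L0 K (Fin 3) (slQ K w) = slQ K w := fun h => by
    rw [L0_slQ, h]
  have hD : ∀ {D : Module.End K (W K)} {w : W K}, slQ K (D w) = -D (slQ K w) → D w = 0 →
      D (slQ K w) = 0 := fun h h0 => by
    rw [h0, map_zero, zero_eq_neg] at h
    exact h
  fin_cases p
  · obtain ⟨h0, h1, h2⟩ := mem_summand_zero.1 hw
    exact mem_summand_zero.2 ⟨hL h0, hD (slQ_slh w) h1, hD (slQ_slr w) h2⟩
  · obtain ⟨h0, h1, h2⟩ := mem_summand_one.1 hw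
    exact mem_summand_one.2 ⟨hL h0, hD (slQ_slh w) h1, hD (slQ_slt w) h2⟩
  · obtain ⟨h0, h1, h2⟩ := mem_summand_two.1 hw
    exact mem_summand_two.2 ⟨hL h0, hD (slQ_slk w) h1, hD (slQ_slr w) h2⟩
  · obtain ⟨h0, h1, h2⟩ := mem_summand_three.1 hw
    exact mem_summand_three.2 ⟨hL h0, hD (slQ_slk w) h1, hD (slQ_slt w) h2⟩

/-- The inverse is -r: in weight one rt + tr = -1, so rt = -1 on the kernel of r and tr = -1 on the
kernel of t. -/
theorem bijOn_slt : Set.BijOn (slt K) (summand K 0) (summand K 1) := by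
  refine ⟨fun w hw => ?_, fun v hv w hw h => ?_, fun w hw => ?_⟩
  · obtain ⟨h0, h1, h2⟩ := mem_summand_zero.1 hw
    exact mem_summand_one.2 ⟨by rw [L0_slt, h0], by rw [slh_slt, h1]; simp, slt_slt w⟩
  · obtain ⟨hv0, hv1, hv2⟩ := mem_summand_zero.1 hv
    obtain ⟨hw0, hw1, hw2⟩ := mem_summand_zero.1 hw
    have h' := congrArg (slr K) h
    rw [slr_slt, slr_slt, hv0, hw0, hv2, hw2] at h'
    simpa using h'
  · obtain ⟨h0, h1, h2⟩ := mem_summand_one.1 hw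
    refine ⟨-slr K w, mem_summand_zero.2 ⟨?_, ?_, ?_⟩, ?_⟩
    · rw [map_neg, L0_slr, h0]
    · rw [map_neg, slh_slr, h1]; simp
    · rw [map_neg, slr_slr, neg_zero]
    · rw [map_neg, slt_slr h0, h2]; simp

/-- The inverse is -h, since hk = -1 on the kernel of h and kh = -1 on the kernel of k. -/
theorem bijOn_slk : Set.BijOn (slk K) (summand K 0) (summand K 2) := by
  refine ⟨fun w hw => ?_, fun v hv w hw h => ?_, fun w hw => ?_⟩
  · obtain ⟨h0, h1, h2⟩ := mem_summand_zero.1 hw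
    exact mem_summand_two.2 ⟨by rw [L0_homotopy, h0], homotopy_homotopy w,
      by rw [← neg_eq_zero, ← slk_slr, h2, map_zero]⟩
  · obtain ⟨hv0, hv1, hv2⟩ := mem_summand_zero.1 hv
    obtain ⟨hw0, hw1, hw2⟩ := mem_summand_zero.1 hw
    have h' := congrArg (slh K) h
    rw [koszul_homotopy, koszul_homotopy, hv0, hw0, hv1, hw1] at h'
    simpa using h'
  · obtain ⟨h0, h1, h2⟩ := mem_summand_two.1 hw
    refine ⟨-slh K w, mem_summand_zero.2 ⟨?_, ?_, ?_⟩, ?_⟩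
    · rw [map_neg, L0_koszul, h0]
    · rw [map_neg, koszul_koszul, neg_zero]
    · rw [map_neg, ← slh_slr, h2, map_zero]
    · rw [map_neg, slk_slh h0, h1]; simp

theorem bijOn_slk_summand_one : Set.BijOn (slk K) (summand K 1) (summand K 3) := by
  refine ⟨fun w hw => ?_, fun v hv w hw h => ?_, fun w hw => ?_⟩
  · obtain ⟨h0, h1, h2⟩ := mem_summand_one.1 hw
    exact mem_summand_three.2 ⟨by rw [L0_homotopy, h0], homotopy_homotopy w,
      by rw [← neg_eq_zero, ← slk_slt, h2, map_zero]⟩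
  · obtain ⟨hv0, hv1, hv2⟩ := mem_summand_one.1 hv
    obtain ⟨hw0, hw1, hw2⟩ := mem_summand_one.1 hw
    have h' := congrArg (slh K) h
    rw [koszul_homotopy, koszul_homotopy, hv0, hw0, hv1, hw1] at h'
    simpa using h'
  · obtain ⟨h0, h1, h2⟩ := mem_summand_three.1 hw
    refine ⟨-slh K w, mem_summand_one.2 ⟨?_, ?_, ?_⟩, ?_⟩
    · rw [map_neg, L0_koszul, h0]
    · rw [map_neg, koszul_koszul, neg_zero]
    · rw [map_neg, ← slh_slt, h2, map_zero]
    · rw [map_neg, slk_slh h0, h1]; simp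

theorem bijOn_slk_mul_slt : Set.BijOn (slk K * slt K) (summand K 0) (summand K 3) :=
  bijOn_slk_summand_one.comp bijOn_slt

end Decomposition

/-! ### The four families: closedness of the first and its images. -/

section Families

variable {K : Type*} [Field K]

/-- Powers of `v^{(3)}` commute with every operator with which `v^{(3)}` commutes. -/
theorem apply_v3_pow {D : Module.End K (W K)} (h : ∀ w, D (v3 K w) = v3 K (D w)) (n : ℕ)
    (w : W K) : D ((v3 K ^ n) w) = (v3 K ^ n) (D w) := by
  have hc : Commute D (v3 K) := LinearMap.ext h
  exact LinearMap.congr_fun (hc.pow_right n).eq w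

theorem v3_apply (w : W K) : v3 K w = mode K .gamma 0 2 (mode K .gamma 0 2 w) +
    mode K .gamma 0 0 (mode K .gamma 0 1 w) := rfl

theorem v4_apply (w : W K) : v4 K w = mode K .gamma 0 2 (mode K .gamma (-1) 2 w) +
    (1 / 2 : K) • mode K .gamma 0 0 (mode K .gamma (-1) 1 w) +
    (1 / 2 : K) • mode K .gamma 0 1 (mode K .gamma (-1) 0 w) := rfl

theorem v5_apply (w : W K) : v5 K w = mode K .beta (-1) 2 (mode K .gamma 0 2 w) +
    mode K .beta (-1) 0 (mode K .gamma 0 0 w) + mode K .beta (-1) 1 (mode K .gamma 0 1 w) := rfl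

theorem b_v3_pow (m : ℤ) (u : Fin 3) (n : ℕ) (w : W K) :
    mode K .b m u ((v3 K ^ n) w) = (v3 K ^ n) (mode K .b m u w) :=
  apply_v3_pow (fun w => by simp [v3_apply, gamma_b]) n w

theorem c_v3_pow (m : ℤ) (u : Fin 3) (n : ℕ) (w : W K) :
    mode K .c m u ((v3 K ^ n) w) = (v3 K ^ n) (mode K .c m u w) :=
  apply_v3_pow (fun w => by simp [v3_apply, gamma_c]) n w

theorem gamma_v3_pow (m : ℤ) (u : Fin 3) (n : ℕ) (w : W K) :
    mode K .gamma m u ((v3 K ^ n) w) = (v3 K ^ n) (mode K .gamma m u w) :=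
  apply_v3_pow (fun w => by simp [v3_apply, gamma_gamma m]) n w

theorem beta_v3_pow {m : ℤ} (hm : m ≠ 0) (u : Fin 3) (n : ℕ) (w : W K) :
    mode K .beta m u ((v3 K ^ n) w) = (v3 K ^ n) (mode K .beta m u w) :=
  apply_v3_pow (fun w => by simp [v3_apply, beta_gamma m, hm]) n w

theorem slh_v3_pow (n : ℕ) (w : W K) : slh K ((v3 K ^ n) w) = (v3 K ^ n) (slh K w) :=
  apply_v3_pow (fun w => by simp [v3_apply, koszul_gamma]) n w

/-- k sends γ_m to m c_m, which vanishes for the modes γ_0 in v3. -/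
theorem slk_v3_pow (n : ℕ) (w : W K) : slk K ((v3 K ^ n) w) = (v3 K ^ n) (slk K w) :=
  apply_v3_pow (fun w => by simp [v3_apply, homotopy_gamma]) n w

theorem L0_v3_pow (n : ℕ) (w : W K) :
    L0 K (Fin 3) ((v3 K ^ n) w) = (v3 K ^ n) (L0 K (Fin 3) w) :=
  apply_v3_pow (fun w => by simp [v3_apply, L0_mode]) n w

theorem b_v4_vac (m : ℤ) (hm : 0 ≤ m) (u : Fin 3) :
    mode K .b m u (v4 K (vac K (Fin 3))) = 0 := by
  simp [v4_apply, ← gamma_b, mode_vac (K := K) (s := .b) (n := m) u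
    (by simp [Kind.creation]; omega)]

theorem c_v4_vac (m : ℤ) (hm : 1 ≤ m) (u : Fin 3) :
    mode K .c m u (v4 K (vac K (Fin 3))) = 0 := by
  simp [v4_apply, ← gamma_c, mode_vac (K := K) (s := .c) (n := m) u
    (by simp [Kind.creation]; omega)]

theorem gamma_v4_vac (m : ℤ) (hm : 1 ≤ m) (u : Fin 3) :
    mode K .gamma m u (v4 K (vac K (Fin 3))) = 0 := by
  simp [v4_apply, gamma_gamma m, mode_vac (K := K) (s := .gamma) (n := m) u
    (by simp [Kind.creation]; omega)]

/-- The bound is 2 because β_0 and β_1 pair with the modes γ_0 and γ_{-1} of v4. -/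
theorem beta_v4_vac (m : ℤ) (hm : 2 ≤ m) (u : Fin 3) :
    mode K .beta m u (v4 K (vac K (Fin 3))) = 0 := by
  have h1 : -1 + m ≠ 0 := by omega
  have h2 : m ≠ 0 := by omega
  simp [v4_apply, beta_gamma m, h1, h2,
    mode_vac (K := K) (s := .beta) (n := m) u (by simp [Kind.creation]; omega)]

/-- The part of `Q` which acts on polynomials in `γ_0` and `γ_{-1}`. -/
theorem slQ_apply_of_killed {x : W K} (hb : ∀ m u, 0 ≤ m → mode K .b m u x = 0)
    (hc : ∀ m u, 1 ≤ m → mode K .c m u x = 0) (hg : ∀ m u, 1 ≤ m → mode K .gamma m u x = 0)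
    (hβ : ∀ m u, 2 ≤ m → mode K .beta m u x = 0) :
    slQ K x = qTerm 0 0 x + qTerm 1 0 x + qTerm 0 1 x := by
  rw [slQ_apply, finsum_eq_sum_of_support_subset (s := {(0, 0), (1, 0), (0, 1)})]
  · simp [add_assoc]
  · rintro ⟨i, j⟩ hp
    by_contra hcon
    simp only [Finset.coe_insert, Finset.coe_singleton, Set.mem_insert_iff, Prod.mk.injEq,
      Set.mem_singleton_iff, not_or, not_and] at hcon
    apply hp
    dsimp only
    by_cases hj : j < 0
    · simp [qTerm, sl2Contract, ← beta_c, fun u => hc (-j) u (by omega)]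
    · by_cases hi : i < 0
      · simp [qTerm, sl2Contract, gamma_c, gamma_beta, c_c (-i) (-j),
          fun u => hc (-i) u (by omega), fun u => hg (-i) u (by omega)]
      -- Both indices are now nonnegative and the pair is none of the three listed, so b_{i+j} and
      -- β_{i+j} annihilate.
      · have h2 : 2 ≤ i + j := by omega
        simp [qTerm, sl2Contract, b_c, fun u => hb (i + j) u (by omega),
          fun u => hβ (i + j) u h2]

/-- v3 is an invariant quadratic form, so the coadjoint action on the γ_0 kills it. The listed
instances of `gamma_gamma` fix an order of the commuting factors. -/
theorem qTerm_zero_zero_v3 (x : W K) : qTerm 0 0 (v3 K x) = v3 K (qTerm 0 0 x) := by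
  simp [qTerm, sl2Contract, v3_apply, beta_gamma, gamma_c, gamma_b, gamma_gamma (ι := Fin 3) 0 0 2 0,
    gamma_gamma (ι := Fin 3) 0 0 2 1, gamma_gamma (ι := Fin 3) 0 0 1 0]
  module

/-- The only even annihilator in this term is β_1, which commutes with the γ_0. -/
theorem qTerm_one_zero_v3 (x : W K) : qTerm 1 0 (v3 K x) = v3 K (qTerm 1 0 x) := by
  simp [qTerm, sl2Contract, v3_apply, beta_gamma, gamma_c, gamma_b, gamma_gamma (-1) 0]
  module

theorem qTerm_zero_one_v3 (x : W K) : qTerm 0 1 (v3 K x) = v3 K (qTerm 0 1 x) := by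
  simp [qTerm, sl2Contract, v3_apply, beta_gamma, gamma_c, gamma_b, gamma_gamma (ι := Fin 3) 0 0 2 0,
    gamma_gamma (ι := Fin 3) 0 0 2 1, gamma_gamma (ι := Fin 3) 0 0 1 0]
  module

variable [CharZero K]

theorem slr_v3_pow (n : ℕ) (w : W K) : slr K ((v3 K ^ n) w) = (v3 K ^ n) (slr K w) :=
  apply_v3_pow (fun w => by simp [v3_apply, slr_gamma]) n w

/-- The commutator of t with γ_0 is a multiple of b_0, which passes through the γ's and kills `w`.
-/
theorem slt_v3_pow (n : ℕ) {w : W K} (hw : ∀ u, mode K .b 0 u w = 0) :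
    slt K ((v3 K ^ n) w) = (v3 K ^ n) (slt K w) := by
  induction n with
  | zero => simp
  | succ n ih =>
    have hb : ∀ u, mode K .b 0 u ((v3 K ^ n) w) = 0 := fun u => by rw [b_v3_pow, hw, map_zero]
    rw [pow_succ', Module.End.mul_apply, Module.End.mul_apply, ← ih]
    simp [v3_apply, slt_gamma, ← gamma_b, hb]

theorem L0_v4_vac : L0 K (Fin 3) (v4 K (vac K (Fin 3))) = v4 K (vac K (Fin 3)) := by
  simp [v4_apply, L0_mode, L0_vac]
  module

theorem family_zero_eq (n : ℕ) : family K 0 n = (v3 K ^ n) (v4 K (vac K (Fin 3))) := rfl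

theorem family_zero_mem (n : ℕ) : family K 0 n ∈ summand K 0 := by
  rw [mem_summand_zero, family_zero_eq]
  refine ⟨by rw [L0_v3_pow, L0_v4_vac], ?_, ?_⟩
  · simp [slh_v3_pow, v4_apply, koszul_gamma, koszul_vac]
  · simp [slr_v3_pow, v4_apply, slr_gamma, slr_vac]

/-- t replaces γ_{-1} by -b_{-1}; the factor 2 from φ⁻¹ absorbs the halves in v4, and replacing γ_0
produces b_0, which kills the vacuum. -/
theorem slt_family_zero (n : ℕ) : slt K (family K 0 n) = -family K 1 n := by
  rw [family_zero_eq, slt_v3_pow n fun u => b_v4_vac 0 le_rfl u]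
  change _ = -(v3 K ^ n) (stateH K)
  rw [← map_neg]
  congr 1
  have hb : ∀ u, mode K .b 0 u (vac K (Fin 3)) = 0 := fun u =>
    mode_vac u (by simp [Kind.creation])
  simp [v4_apply, stateH, slt_gamma, slt_vac, Fin.sum_univ_three, sl2Swap, sl2Scale,
    ← gamma_b, hb]
  module

theorem slk_family_zero (n : ℕ) : slk K (family K 0 n) = -family K 2 n := by
  rw [family_zero_eq, slk_v3_pow]
  change _ = -(v3 K ^ n) (stateR K)
  rw [← map_neg]
  congr 1
  simp [v4_apply, stateR, homotopy_gamma, homotopy_vac, Fin.sum_univ_three, sl2Swap, sl2Scale,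
    sl2Phi_apply]
  module

theorem slk_slt_family_zero (n : ℕ) : (slk K * slt K) (family K 0 n) = family K 3 n := by
  rw [Module.End.mul_apply, slt_family_zero]
  change slk K (-(v3 K ^ n) (stateH K)) = (v3 K ^ n) (v5 K (vac K (Fin 3)))
  rw [map_neg, slk_v3_pow, ← map_neg]
  congr 1
  simp [v5_apply, stateH, homotopy_gamma, homotopy_b, homotopy_vac, Fin.sum_univ_three, gamma_beta]
  module

/-- v4 is the polarised invariant form evaluated on γ_0 and γ_{-1}. The two terms with c_0 cancel by
invariance. The term with c_{-1} turns γ_{-1} into a rotated γ_0 and vanishes because ad is skew for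
the form. -/
theorem slQ_v4_vac : slQ K (v4 K (vac K (Fin 3))) = 0 := by
  rw [slQ_apply_of_killed (fun m u h => b_v4_vac m h u) (fun m u h => c_v4_vac m h u)
    (fun m u h => gamma_v4_vac m h u) (fun m u h => beta_v4_vac m h u)]
  have hβ (m : ℤ) (h : 0 ≤ m) (u : Fin 3) : mode K .beta m u (vac K (Fin 3)) = 0 :=
    mode_vac u (by simp [Kind.creation]; omega)
  have hb (m : ℤ) (h : 0 ≤ m) (u : Fin 3) : mode K .b m u (vac K (Fin 3)) = 0 :=
    mode_vac u (by simp [Kind.creation]; omega)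
  simp [qTerm, sl2Contract, v4_apply, beta_gamma, gamma_c, b_c, ← gamma_b, hβ, hb,
    gamma_gamma (ι := Fin 3) 0 0 2 0, gamma_gamma (ι := Fin 3) 0 0 2 1, gamma_gamma (ι := Fin 3) 0 0 1 0, gamma_gamma (-1) 0]
  module

theorem slQ_family_zero (n : ℕ) : slQ K (family K 0 n) = 0 := by
  have h0 := slQ_v4_vac (K := K)
  rw [slQ_apply_of_killed (fun m u h => b_v4_vac m h u) (fun m u h => c_v4_vac m h u)
    (fun m u h => gamma_v4_vac m h u) (fun m u h => beta_v4_vac m h u)] at h0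
  rw [family_zero_eq, slQ_apply_of_killed]
  · have h (i j : ℤ) (hq : ∀ x, qTerm i j (v3 K x) = v3 K (qTerm i j x)) (m : ℕ) (x : W K) :
        qTerm i j ((v3 K ^ m) x) = (v3 K ^ m) (qTerm i j x) := by
      induction m with
      | zero => rfl
      | succ m ih => rw [pow_succ', Module.End.mul_apply, Module.End.mul_apply, hq, ih]
    rw [h 0 0 qTerm_zero_zero_v3, h 1 0 qTerm_one_zero_v3, h 0 1 qTerm_zero_one_v3, ← map_add,
      ← map_add, h0, map_zero]
  · intro m u hm; rw [b_v3_pow, b_v4_vac m hm, map_zero]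
  · intro m u hm; rw [c_v3_pow, c_v4_vac m hm, map_zero]
  · intro m u hm; rw [gamma_v3_pow, gamma_v4_vac m hm, map_zero]
  · intro m u hm; rw [beta_v3_pow (by omega), beta_v4_vac m hm, map_zero]

end Families

/-! ### Functionals vanishing on the image of Q, and independence of the classes. -/

section Detection

open Polynomial

variable {K : Type*} [Field K]

variable (K) in
/-- The substitution `γ_0^{h'} ↦ X` which sends the other even creation operators to zero. -/
def cartanSymbol : Osc (Fin 3) → K[X]
  | .up 2 0 => X
  | _ => 0

variable (K) in
/-- The coefficient of `b_{-1}^h` after the substitution `cartanSymbol`. -/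
def cartanCoeff : W K →ₗ[K] K[X] :=
  (TensorProduct.rid K K[X]).toLinearMap ∘ₗ
    TensorProduct.map (MvPolynomial.aeval (cartanSymbol K)).toLinearMap
      (ExteriorAlgebra.algebraMapInv.toLinearMap ∘ₗ
        CliffordAlgebra.contractLeft (Q := (0 : QuadraticForm K (Osc (Fin 3) →₀ K)))
          (Finsupp.lapply (.low 2 0)))

theorem cartanCoeff_symMul (g : Osc (Fin 3)) (w : W K) :
    cartanCoeff K (symMul K g w) = cartanSymbol K g * cartanCoeff K w := by
  induction w using TensorProduct.induction_on with
  | zero => simp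
  | tmul p e => simp [cartanCoeff, symMul]
  | add x y hx hy => simp only [map_add, hx, hy, mul_add]

/-- Contracting the product either pairs distinct oscillators or leaves a factor of positive
exterior degree, which has no scalar part. -/
theorem cartanCoeff_extMul {g : Osc (Fin 3)} (hg : g ≠ .low 2 0) (w : W K) :
    cartanCoeff K (extMul K g w) = 0 := by
  induction w using TensorProduct.induction_on with
  | zero => simp
  | tmul p e =>
    have h0 : ExteriorAlgebra.algebraMapInv
        (ExteriorAlgebra.ι K (Finsupp.single g (1 : K))) = 0 := by
      simp [ExteriorAlgebra.algebraMapInv]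
    simp only [cartanCoeff, extMul, LinearMap.comp_apply, LinearMap.lTensor_tmul,
      TensorProduct.map_tmul, LinearMap.mulLeft_apply]
    rw [ExteriorAlgebra.ι, CliffordAlgebra.contractLeft_ι_mul]
    rw [ExteriorAlgebra.ι] at h0
    simp [hg, h0]
  | add x y hx hy => simp only [map_add, hx, hy, add_zero]

theorem cartanCoeff_gamma_zero (u : Fin 3) (w : W K) :
    cartanCoeff K (mode K .gamma 0 u w) = (if u = 2 then X else 0) * cartanCoeff K w := by
  refine (cartanCoeff_symMul (.up u 0) w).trans ?_
  fin_cases u <;> simp [cartanSymbol]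

theorem cartanCoeff_gamma {m : ℤ} (hm : m ≤ -1) (u : Fin 3) (w : W K) :
    cartanCoeff K (mode K .gamma m u w) = 0 := by
  obtain ⟨n, rfl⟩ := Int.eq_negSucc_of_lt_zero (by omega : m < 0)
  refine (cartanCoeff_symMul (.up u (n + 1)) w).trans ?_
  simp [cartanSymbol]

theorem cartanCoeff_beta {m : ℤ} (hm : m ≤ -1) (u : Fin 3) (w : W K) :
    cartanCoeff K (mode K .beta m u w) = 0 := by
  obtain ⟨n, rfl⟩ := Int.eq_negSucc_of_lt_zero (by omega : m < 0)
  refine (cartanCoeff_symMul (.low u n) w).trans ?_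
  simp [cartanSymbol]

theorem cartanCoeff_c {m : ℤ} (hm : m ≤ 0) (u : Fin 3) (w : W K) :
    cartanCoeff K (mode K .c m u w) = 0 := by
  rcases hm.lt_or_eq with hm | rfl
  · obtain ⟨n, rfl⟩ := Int.eq_negSucc_of_lt_zero hm
    exact cartanCoeff_extMul (g := .up u (n + 1)) (by simp) w
  · exact cartanCoeff_extMul (g := .up u 0) (by simp) w

theorem cartanCoeff_b {m : ℤ} (hm : m ≤ -2) (u : Fin 3) (w : W K) :
    cartanCoeff K (mode K .b m u w) = 0 := by
  obtain ⟨n, rfl⟩ := Int.eq_negSucc_of_lt_zero (by omega : m < 0)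
  refine cartanCoeff_extMul (g := .low u n) ?_ w
  rw [Int.negSucc_eq] at hm
  simp
  omega

/-- Up to vanishing traces of ad, each product can be reordered to start with c_n (n ≤ 0), γ_n or
β_n (n ≤ -1), or b_n (n ≤ -2). The functional kills everything of this form. -/
theorem cartanCoeff_qTerm (i j : ℤ) (x : W K) : cartanCoeff K (qTerm i j x) = 0 := by
  rw [qTerm, map_add, map_smul]
  by_cases hj : 0 ≤ j
  · have hc := cartanCoeff_c (K := K) (by omega : -j ≤ 0)
    simp [sl2Contract, gamma_c, c_c (-i) (-j), b_c, hc]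
  · by_cases hi : 0 ≤ i
    · have hc := cartanCoeff_c (K := K) (by omega : -i ≤ 0)
      have hγ : 0 < i → ∀ u (w : W K), cartanCoeff K (mode K .gamma (-i) u w) = 0 :=
        fun h => cartanCoeff_gamma (by omega)
      have hβ : i ≤ 0 → ∀ u (w : W K), cartanCoeff K (mode K .beta (i + j) u w) = 0 :=
        fun h => cartanCoeff_beta (by omega)
      rcases lt_or_ge 0 i with h | h
      · simp [sl2Contract, b_c, hc, hγ h]
      · simp [sl2Contract, b_c, ← beta_c, gamma_beta, hc, hβ h]
    -- Two negative indices add up to at most -2, so the mode b_{-1} cannot be created.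
    · have hb := cartanCoeff_b (K := K) (by omega : i + j ≤ -2)
      have hβ := cartanCoeff_beta (K := K) (by omega : i + j ≤ -1)
      simp [sl2Contract, ← beta_c, gamma_beta, hb, hβ]

theorem cartanCoeff_slQ (x : W K) : cartanCoeff K (slQ K x) = 0 := by
  rw [slQ_apply, map_finsum _ (finite_support_qTerm x)]
  simp [cartanCoeff_qTerm]

theorem cartanCoeff_v3_pow (n : ℕ) (w : W K) :
    cartanCoeff K ((v3 K ^ n) w) = X ^ (2 * n) * cartanCoeff K w := by
  induction n with
  | zero => simp
  | succ n ih =>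
    rw [pow_succ', Module.End.mul_apply, v3_apply]
    simp only [map_add, cartanCoeff_gamma_zero, ih]
    simp
    ring

theorem cartanCoeff_stateH : cartanCoeff K (stateH K) = X := by
  have h : cartanCoeff K (mode K .b (-1) 2 (vac K (Fin 3))) = 1 := by
    change cartanCoeff K (extMul K (.low 2 0) (vac K (Fin 3))) = 1
    simp only [cartanCoeff, extMul, vac, LinearMap.comp_apply, LinearMap.lTensor_tmul,
      TensorProduct.map_tmul, LinearMap.mulLeft_apply]
    rw [ExteriorAlgebra.ι, CliffordAlgebra.contractLeft_ι_mul]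
    simp
  simp [stateH, Fin.sum_univ_three, cartanCoeff_gamma_zero, h]

variable [CharZero K]

theorem cartanCoeff_family_one (n : ℕ) : cartanCoeff K (family K 1 n) = X ^ (2 * n + 1) := by
  change cartanCoeff K ((v3 K ^ n) (stateH K)) = _
  rw [cartanCoeff_v3_pow, cartanCoeff_stateH, pow_succ]

variable (K) in
/-- Linear maps which vanish on the image of `Q` and separate the members of the families. -/
def familyDetector : Fin 4 → W K →ₗ[K] K[X] :=
  ![-(cartanCoeff K ∘ₗ slt K), cartanCoeff K, -(cartanCoeff K ∘ₗ slt K ∘ₗ slh K),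
    cartanCoeff K ∘ₗ slh K]

/-- h and t anticommute with Q, so composing with them preserves vanishing on exact elements. -/
theorem familyDetector_slQ (p : Fin 4) (x : W K) : familyDetector K p (slQ K x) = 0 := by
  have hh : slh K (slQ K x) = -slQ K (slh K x) := by rw [slQ_slh, neg_neg]
  have ht (y : W K) : slt K (slQ K y) = -slQ K (slt K y) := by rw [slQ_slt, neg_neg]
  fin_cases p <;> simp [familyDetector, hh, ht, cartanCoeff_slQ]

theorem slh_family_two (n : ℕ) : slh K (family K 2 n) = family K 0 n := by
  obtain ⟨h0, h1, -⟩ := mem_summand_zero.1 (family_zero_mem (K := K) n)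
  rw [← neg_neg (family K 2 n), ← slk_family_zero, map_neg, koszul_homotopy, h0, h1]
  simp

theorem family_one_mem (n : ℕ) : family K 1 n ∈ summand K 1 := by
  have h := bijOn_slt.mapsTo (family_zero_mem (K := K) n)
  rw [slt_family_zero] at h
  exact neg_mem_iff.1 h

theorem slh_family_three (n : ℕ) : slh K (family K 3 n) = family K 1 n := by
  obtain ⟨h0, h1, -⟩ := mem_summand_one.1 (family_one_mem (K := K) n)
  rw [← slk_slt_family_zero, Module.End.mul_apply, slt_family_zero, map_neg, map_neg,
    koszul_homotopy, h0, h1]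
  simp

/-- h undoes k up to sign, so every family is carried to the second one; the signs in
`familyDetector` make all the values equal. -/
theorem familyDetector_family (p : Fin 4) (n : ℕ) :
    familyDetector K p (family K p n) = X ^ (2 * n + 1) := by
  fin_cases p <;> simp [familyDetector, slh_family_two, slh_family_three, slt_family_zero,
    cartanCoeff_family_one]

theorem family_mem_summand (p : Fin 4) (n : ℕ) : family K p n ∈ summand K p := by
  fin_cases p
  · exact family_zero_mem n
  · exact family_one_mem n
  · have h := bijOn_slk.mapsTo (family_zero_mem (K := K) n)
    rw [slk_family_zero] at h
    exact neg_mem_iff.1 h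
  · have h := bijOn_slk_mul_slt.mapsTo (family_zero_mem (K := K) n)
    rwa [slk_slt_family_zero] at h

theorem family_notMem_range (p : Fin 4) (n : ℕ) :
    family K p n ∉ LinearMap.range (slQ K) := by
  rintro ⟨x, hx⟩
  have h := familyDetector_family (K := K) p n
  rw [← hx, familyDetector_slQ] at h
  exact pow_ne_zero _ X_ne_zero h.symm

theorem slQ_family (p : Fin 4) (n : ℕ) : slQ K (family K p n) = 0 := by
  have h1 : slQ K (family K 1 n) = 0 := by
    rw [← neg_neg (family K 1 n), ← slt_family_zero, map_neg, slQ_slt, slQ_family_zero]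
    simp
  fin_cases p
  · exact slQ_family_zero n
  · exact h1
  · change slQ K (family K 2 n) = 0
    rw [← neg_neg (family K 2 n), ← slk_family_zero, map_neg, slQ_slk, slQ_family_zero]
    simp
  · change slQ K (family K 3 n) = 0
    rw [← slk_slt_family_zero, Module.End.mul_apply, slt_family_zero, map_neg, map_neg, slQ_slk, h1]
    simp

theorem linearIndependent_family (p : Fin 4)
    (hQ : ∀ n, family K p n ∈ LinearMap.ker (slQ K)) :
    LinearIndependent K fun n : ℕ =>
      (Submodule.Quotient.mk ⟨family K p n, hQ n⟩ : Cohomology (slQ K)) := by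
  -- The detector descends to cohomology because it kills exact elements.
  let f : Cohomology (slQ K) →ₗ[K] K[X] :=
    Submodule.liftQ _ ((familyDetector K p).domRestrict (LinearMap.ker (slQ K))) (by
      rintro ⟨_, _⟩ ⟨x, rfl⟩
      exact familyDetector_slQ p x)
  refine LinearIndependent.of_comp f ?_
  -- The classes map to monomials of the pairwise distinct degrees 2n + 1.
  have h := (basisMonomials K).linearIndependent.comp (fun n : ℕ => 2 * n + 1)
    fun a b hab => by simpa using hab
  convert h using 1
  funext n
  refine (familyDetector_family p n).trans ?_
  simp [X_pow_eq_monomial]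

end Detection

end VOWA

end

open VOWA in
theorem theorem5 (K : Type*) [Field K] [CharZero K] [IsAlgClosed K] :
    -- the decomposition of the subspace of weight one into four `Q`-stable summands
    (iSupIndep (summand K) ∧ iSup (summand K) = W1 K ∧
      ∀ p, ∀ w ∈ summand K p, slQ K w ∈ summand K p) ∧
    -- the isomorphisms of the first summand with the other three, which commute with `Q`
    -- up to sign
    (Set.BijOn (slt K) (summand K 0) (summand K 1) ∧
      Set.BijOn (slk K) (summand K 0) (summand K 2) ∧
      Set.BijOn (slk K * slt K) (summand K 0) (summand K 3) ∧
      (∀ w, slQ K (slt K w) = -slt K (slQ K w)) ∧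
      (∀ w, slQ K (slk K w) = -slk K (slQ K w))) ∧
    -- the first family is in the kernels of `Q`, `h`, `r`, and its images are the other families
    (∀ n : ℕ,
      family K 0 n ∈ LinearMap.ker (slQ K) ⊓ LinearMap.ker (slh K) ⊓ LinearMap.ker (slr K) ∧
      slt K (family K 0 n) = -family K 1 n ∧
      slk K (family K 0 n) = -family K 2 n ∧
      (slk K * slt K) (family K 0 n) = family K 3 n) ∧
    -- all members of the four families are closed, of weight one, in the respective summands,
    -- and not exact
    (∀ p n, family K p n ∈ summand K p ∧ family K p n ∉ LinearMap.range (slQ K)) ∧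
    ∃ hQ : ∀ p n, family K p n ∈ LinearMap.ker (slQ K),
      -- each family gives infinitely many classes, in fact linearly independent ones
      ∀ p, LinearIndependent K fun n : ℕ =>
        (Submodule.Quotient.mk ⟨family K p n, hQ p n⟩ : Cohomology (slQ K)) := by
  refine ⟨⟨iSupIndep_summand, iSup_summand, slQ_mem_summand⟩,
    ⟨bijOn_slt, bijOn_slk, bijOn_slk_mul_slt, slQ_slt, slQ_slk⟩, fun n => ⟨?_, slt_family_zero n,
      slk_family_zero n, slk_slt_family_zero n⟩,
    fun p n => ⟨family_mem_summand p n, family_notMem_range p n⟩,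
    fun p n => slQ_family p n, fun p => linearIndependent_family p _⟩
  obtain ⟨-, h1, h2⟩ := mem_summand_zero.1 (family_zero_mem (K := K) n)
  exact ⟨⟨slQ_family_zero n, h1⟩, h2⟩
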